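/- **Lemma 5.6.** Let $T\ge 0$ and let $\mathbb{S}(k)$ be the space of real symmetric $k\times k$ matrices, ordered by $A\ge B$ iff $A-B$ is positive semidefinite. Let $G:\mathbb{S}(d)\to\mathbb{R}$ be monotone, sublinear (subadditive and positively homogeneous) and non-degenerate: there are $0<\underline{\sigma}^2\le\bar\sigma^2<\infty$ with $\frac12\underline{\sigma}^2\,\mathrm{tr}[A-B]\le G(A)-G(B)\le\frac12\bar\sigma^2\,\mathrm{tr}[A-B]$ for all $A\ge B$. Let $b,\ h_{ij}=h_{ji}:\mathbb{R}^+\times\mathbb{R}^n\to\mathbb{R}^n$, $\sigma:\mathbb{R}^+\times\mathbb{R}^n\to\mathbb{R}^{n\times d}$, $f,\ g_{ij}=g_{ji}:\mathbb{R}^+\times\mathbb{R}^n\times\mathbb{R}\times\mathbb{R}^{1\times d}\to\mathbb{R}$ ($1\le i,j\le d$), $\varphi:\mathbb{R}^n\to\mathbb{R}$ and $S:[0,T]\times\mathbb{R}^n\to\mathbb{R}$ be continuous functions such that: (H1) there is $L>0$ with $|\vartheta(s,x)-\vartheta(s,x')|\le L|x-x'|$ and $|\vartheta(s,0)|\le L$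 for all $s\in\mathbb{R}^+$, $x,x'\in\mathbb{R}^n$ and $\vartheta=b,h_{ij},\sigma$ (Frobenius norm for $\sigma$); (H2) there are $L>0$ and a positive integer $m$ with $$|\vartheta(s,x,y,z)-\vartheta(s,x',y',z')|\le L\big((1+|x|^m+|x'|^m)|x-x'|+|y-y'|+|z-z'|\big),\qquad |\vartheta(s,0,0,0)|\le L$$ for all $s\in\mathbb{R}^+$, $x,x'\in\mathbb{R}^n$, $y,y'\in\mathbb{R}$, $z,z'\in\mathbb{R}^{1\times d}$ and $\vartheta=f,g_{ij}$, and likewise $|\varphi(x)-\varphi(x')|\le L(1+|x|^m+|x'|^m)|x-x'|$, $|\varphi(0)|\le L$; (H3) $S$ is Lipschitz continuous in $x$, uniformly in $t\in[0,T]$, and bounded from above, and $S(T,x)\le\varphi(x)$ for all $x\in\mathbb{R}^n$; (H5) for each $(x,v,p,A)\in\mathbb{R}^n\times\mathbb{R}\times\mathbb{R}^{1\times n}\times\mathbb{S}(n)$ the limit $$\bar F(x,v,p,A):=\lim_{s\to\infty}\frac1s\int_0^s\big[p\,b(r,x)+f(r,x,v,p\sigma(r,x))+G(H(r,x,v,p,A))\big]\,dr$$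 exists and is finite, where $H_{ij}(r,x,v,p,A)=(\sigma(r,x)^\top A\,\sigma(r,x))_{ij}+2p\,h_{ij}(r,x)+2g_{ij}(r,x,v,p\sigma(r,x))$. For a function $u$ continuous near $(t,x)\in(0,T)\times\mathbb{R}^n$, let $\mathcal{P}^{2,+}u(t,x)$ be the set of $(p,q,X)\in\mathbb{R}\times\mathbb{R}^{1\times n}\times\mathbb{S}(n)$ with $$u(s,y)\le u(t,x)+p(s-t)+\langle q,y-x\rangle+\tfrac12\langle X(y-x),y-x\rangle+o(|s-t|+|y-x|^2)\quad\text{as }(s,y)\to(t,x),$$ and let $\mathcal{P}^{2,-}u(t,x):=-\mathcal{P}^{2,+}(-u)(t,x)$. A viscosity solution of the averaged obstacle problem $$\min\big(-\partial_t u-\bar F(x,u,D_xu,D_x^2u),\ u-S\big)=0\ \text{ in }(0,T)\times\mathbb{R}^n,\qquad u(T,x)=\varphi(x),\ x\in\mathbb{R}^n,\tag{4.1}$$ is a function $u\in C([0,T]\times\mathbb{R}^n)$ with $u(T,\cdot)=\varphi$ such that, for every $(t,x)\in(0,T)\times\mathbb{R}^n$, one has $\min\big(u(t,x)-S(t,x),\,-p-\bar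 F(x,u(t,x),q,X)\big)\le0$ for all $(p,q,X)\in\mathcal{P}^{2,+}u(t,x)$, and $\min\big(u(t,x)-S(t,x),\,-p-\bar F(x,u(t,x),q,X)\big)\ge0$ for all $(p,q,X)\in\mathcal{P}^{2,-}u(t,x)$. Then (4.1) has at most one viscosity solution $u\in C([0,T]\times\mathbb{R}^n)$ of polynomial growth: if $u$ and $v$ are viscosity solutions of (4.1) and there are $C\ge 0$ and $k\in\mathbb{N}$ with $|u(t,x)|+|v(t,x)|\le C(1+|x|^k)$ for all $(t,x)\in[0,T]\times\mathbb{R}^n$, then $u=v$ on $[0,T]\times\mathbb{R}^n$. -/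

import Mathlib

open Filter Topology
open scoped Matrix

namespace AveragedObstacle

/-- `ℝᵏ` with its Euclidean norm; row vectors in `ℝ^{1×k}` are elements of the same space. -/
abbrev Vec (k : ℕ) : Type := EuclideanSpace ℝ (Fin k)

/-- The Frobenius norm `|M| = (∑ᵢⱼ Mᵢⱼ²)^{1/2}`. -/
noncomputable def frob {m k : ℕ} (M : Matrix (Fin m) (Fin k) ℝ) : ℝ :=
  Real.sqrt (∑ i, ∑ j, M i j ^ 2)

/-- The row vector `p M`. -/
noncomputable def rowMul {m k : ℕ} (p : Vec m) (M : Matrix (Fin m) (Fin k) ℝ) : Vec k :=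
  WithLp.toLp 2 (Matrix.vecMul p.ofLp M)

/-- The closed half-space `ℝ⁺ × X` of times `r ≥ 0`. -/
def nonnegTimes (X : Type) : Set (ℝ × X) := {q | 0 ≤ q.1}

/-- The closed strip `[0,T] × ℝⁿ`. -/
def strip (n : ℕ) (T : ℝ) : Set (ℝ × Vec n) := {q | 0 ≤ q.1 ∧ q.1 ≤ T}

/-- The data: the function `G` on symmetric `d × d` matrices, the coefficients
`b, h_ij, σ, f, g_ij` (whose first argument is a time in `ℝ⁺`), the terminal function `φ` and the
obstacle `S`. The values of `G` at non-symmetric matrices, those of the coefficients at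
negative times, and those of `S` at times outside `[0,T]` are irrelevant: nothing is assumed on
them and nothing below depends on them. -/
structure Coefficients (n d : ℕ) where
  G : Matrix (Fin d) (Fin d) ℝ → ℝ
  b : ℝ → Vec n → Vec n
  h : Fin d → Fin d → ℝ → Vec n → Vec n
  sigma : ℝ → Vec n → Matrix (Fin n) (Fin d) ℝ
  f : ℝ → Vec n → ℝ → Vec d → ℝ
  g : Fin d → Fin d → ℝ → Vec n → ℝ → Vec d → ℝ
  phi : Vec n → ℝ
  S : ℝ → Vec n → ℝ

/-- `G : 𝕊(d) → ℝ` is monotone, sublinear and non-degenerate. `A ≥ B` means that `A - B` is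
positive semidefinite; `s₁, s₂` stand for the two variances of the non-degeneracy condition. -/
structure IsGFunction {d : ℕ} (G : Matrix (Fin d) (Fin d) ℝ → ℝ) : Prop where
  mono : ∀ A B : Matrix (Fin d) (Fin d) ℝ, A.IsSymm → B.IsSymm → (A - B).PosSemidef → G B ≤ G A
  subadd : ∀ A B : Matrix (Fin d) (Fin d) ℝ, A.IsSymm → B.IsSymm → G (A + B) ≤ G A + G B
  pos_homog : ∀ (c : ℝ) (A : Matrix (Fin d) (Fin d) ℝ), 0 ≤ c → A.IsSymm → G (c • A) = c * G A
  nondegenerate : ∃ s₁ s₂ : ℝ, 0 < s₁ ∧ s₁ ≤ s₂ ∧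
    ∀ A B : Matrix (Fin d) (Fin d) ℝ, A.IsSymm → B.IsSymm → (A - B).PosSemidef →
      1 / 2 * s₁ * (A - B).trace ≤ G A - G B ∧ G A - G B ≤ 1 / 2 * s₂ * (A - B).trace

variable {n d : ℕ}

/-- Continuity and symmetry of the coefficients, and the properties of `G`. -/
structure Coefficients.Standing (c : Coefficients n d) (T : ℝ) : Prop where
  isG : IsGFunction c.G
  h_symm : ∀ i j, c.h i j = c.h j i
  g_symm : ∀ i j, c.g i j = c.g j i
  cont_b : ContinuousOn (fun q : ℝ × Vec n => c.b q.1 q.2) (nonnegTimes (Vec n))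
  cont_h : ∀ i j, ContinuousOn (fun q : ℝ × Vec n => c.h i j q.1 q.2) (nonnegTimes (Vec n))
  cont_sigma : ContinuousOn (fun q : ℝ × Vec n => c.sigma q.1 q.2) (nonnegTimes (Vec n))
  cont_f : ContinuousOn (fun q : ℝ × Vec n × ℝ × Vec d => c.f q.1 q.2.1 q.2.2.1 q.2.2.2)
    (nonnegTimes (Vec n × ℝ × Vec d))
  cont_g : ∀ i j, ContinuousOn
    (fun q : ℝ × Vec n × ℝ × Vec d => c.g i j q.1 q.2.1 q.2.2.1 q.2.2.2)
    (nonnegTimes (Vec n × ℝ × Vec d))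
  cont_phi : Continuous c.phi
  cont_S : ContinuousOn (fun q : ℝ × Vec n => c.S q.1 q.2) (strip n T)

/-- Lipschitz continuity in `x`, uniformly in time, of `b`, `h_ij`, `σ`, and boundedness in time
of their values at `x = 0`. -/
def Coefficients.LipschitzForward (c : Coefficients n d) : Prop :=
  ∃ L : ℝ, 0 < L ∧ ∀ s : ℝ, 0 ≤ s →
    (∀ x x' : Vec n,
      ‖c.b s x - c.b s x'‖ ≤ L * ‖x - x'‖ ∧
      (∀ i j, ‖c.h i j s x - c.h i j s x'‖ ≤ L * ‖x - x'‖) ∧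
      frob (c.sigma s x - c.sigma s x') ≤ L * ‖x - x'‖) ∧
    ‖c.b s 0‖ ≤ L ∧ (∀ i j, ‖c.h i j s 0‖ ≤ L) ∧ frob (c.sigma s 0) ≤ L

/-- The local Lipschitz condition on `f`, `g_ij` and `φ`, with polynomial weight in `x`. -/
def Coefficients.LipschitzBackward (c : Coefficients n d) : Prop :=
  ∃ (L : ℝ) (m : ℕ), 0 < L ∧ 0 < m ∧
    (∀ s : ℝ, 0 ≤ s →
      (∀ (x x' : Vec n) (y y' : ℝ) (z z' : Vec d),
        |c.f s x y z - c.f s x' y' z'| ≤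
          L * ((1 + ‖x‖ ^ m + ‖x'‖ ^ m) * ‖x - x'‖ + |y - y'| + ‖z - z'‖) ∧
        ∀ i j, |c.g i j s x y z - c.g i j s x' y' z'| ≤
          L * ((1 + ‖x‖ ^ m + ‖x'‖ ^ m) * ‖x - x'‖ + |y - y'| + ‖z - z'‖)) ∧
      |c.f s 0 0 0| ≤ L ∧ ∀ i j, |c.g i j s 0 0 0| ≤ L) ∧
    (∀ x x' : Vec n, |c.phi x - c.phi x'| ≤ L * ((1 + ‖x‖ ^ m + ‖x'‖ ^ m) * ‖x - x'‖)) ∧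
    |c.phi 0| ≤ L

/-- The obstacle is Lipschitz in `x`, bounded from above, and below `φ` at time `T`. -/
def Coefficients.ObstacleCondition (c : Coefficients n d) (T : ℝ) : Prop :=
  (∃ L : ℝ, ∀ t : ℝ, 0 ≤ t → t ≤ T → ∀ x x' : Vec n, |c.S t x - c.S t x'| ≤ L * ‖x - x'‖) ∧
  (∃ K : ℝ, ∀ t : ℝ, 0 ≤ t → t ≤ T → ∀ x : Vec n, c.S t x ≤ K) ∧
  ∀ x : Vec n, c.S T x ≤ c.phi x

/-- `H_ij(r,x,v,p,A) = (σᵀAσ)_ij + 2 p h_ij + 2 g_ij(r,x,v,pσ)`. -/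
noncomputable def Coefficients.H (c : Coefficients n d) (r : ℝ) (x : Vec n) (v : ℝ) (p : Vec n)
    (A : Matrix (Fin n) (Fin n) ℝ) : Matrix (Fin d) (Fin d) ℝ :=
  Matrix.of fun i j =>
    ((c.sigma r x)ᵀ * A * c.sigma r x) i j + 2 * inner ℝ p (c.h i j r x)
      + 2 * c.g i j r x v (rowMul p (c.sigma r x))

/-- `F(r,x,v,p,A) = G(H(r,x,v,p,A)) + p b(r,x) + f(r,x,v,pσ(r,x))`. -/
noncomputable def Coefficients.F (c : Coefficients n d) (r : ℝ) (x : Vec n) (v : ℝ) (p : Vec n)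
    (A : Matrix (Fin n) (Fin n) ℝ) : ℝ :=
  c.G (c.H r x v p A) + inner ℝ p (c.b r x) + c.f r x v (rowMul p (c.sigma r x))

/-- The time average `s⁻¹ ∫₀ˢ F(r,x,v,p,A) dr`. -/
noncomputable def Coefficients.timeAverage (c : Coefficients n d) (x : Vec n) (v : ℝ) (p : Vec n)
    (A : Matrix (Fin n) (Fin n) ℝ) (s : ℝ) : ℝ :=
  1 / s * ∫ r in (0 : ℝ)..s, c.F r x v p A

/-- The time averages converge to a finite limit as `s → ∞`, for all `(x,v,p)` and symmetric `A`. -/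
def Coefficients.HasAverage (c : Coefficients n d) : Prop :=
  ∀ (x : Vec n) (v : ℝ) (p : Vec n) (A : Matrix (Fin n) (Fin n) ℝ), A.IsSymm →
    ∃ l : ℝ, Tendsto (c.timeAverage x v p A) atTop (𝓝 l)

/-- The averaged nonlinearity `F̄(x,v,p,A) = lim_{s → ∞} s⁻¹ ∫₀ˢ F(r,x,v,p,A) dr`. -/
noncomputable def Coefficients.Fbar (c : Coefficients n d) (x : Vec n) (v : ℝ) (p : Vec n)
    (A : Matrix (Fin n) (Fin n) ℝ) : ℝ :=
  limUnder atTop (c.timeAverage x v p A)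

/-- The quadratic form `⟨X w, w⟩`. -/
noncomputable def quadForm (X : Matrix (Fin n) (Fin n) ℝ) (w : Vec n) : ℝ :=
  (X *ᵥ w.ofLp) ⬝ᵥ w.ofLp

/-- The parabolic superjet: triples `(p,q,X)` with `X` symmetric and
`u(s,y) ≤ u(t,x) + p(s-t) + ⟨q,y-x⟩ + ½⟨X(y-x),y-x⟩ + o(|s-t| + |y-x|²)` as `(s,y) → (t,x)`. -/
def superjet (u : ℝ → Vec n → ℝ) (t : ℝ) (x : Vec n) :
    Set (ℝ × Vec n × Matrix (Fin n) (Fin n) ℝ) :=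
  {J | J.2.2.IsSymm ∧ ∀ ε : ℝ, 0 < ε → ∀ᶠ z : ℝ × Vec n in 𝓝 (t, x),
    u z.1 z.2 ≤ u t x + J.1 * (z.1 - t) + inner ℝ J.2.1 (z.2 - x)
      + 1 / 2 * quadForm J.2.2 (z.2 - x) + ε * (|z.1 - t| + ‖z.2 - x‖ ^ 2)}

/-- The parabolic subjet of `u`, that is, `-(superjet of -u)`. -/
def subjet (u : ℝ → Vec n → ℝ) (t : ℝ) (x : Vec n) :
    Set (ℝ × Vec n × Matrix (Fin n) (Fin n) ℝ) :=
  {J | -J ∈ superjet (fun s y => -u s y) t x}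

/-- Viscosity subsolutions of the averaged obstacle problem
`min(-∂ₜu - F̄(x,u,Du,D²u), u - S) = 0` in `(0,T) × ℝⁿ`, `u(T,·) = φ`. -/
structure Coefficients.IsViscositySubsolution (c : Coefficients n d) (T : ℝ)
    (u : ℝ → Vec n → ℝ) : Prop where
  cont : ContinuousOn (fun q : ℝ × Vec n => u q.1 q.2) (strip n T)
  terminal : ∀ x, u T x ≤ c.phi x
  jet : ∀ (t : ℝ) (x : Vec n), 0 < t → t < T → ∀ (p : ℝ) (q : Vec n)
    (X : Matrix (Fin n) (Fin n) ℝ), (p, q, X) ∈ superjet u t x →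
      min (u t x - c.S t x) (-p - c.Fbar x (u t x) q X) ≤ 0

/-- Viscosity supersolutions of the averaged obstacle problem. -/
structure Coefficients.IsViscositySupersolution (c : Coefficients n d) (T : ℝ)
    (u : ℝ → Vec n → ℝ) : Prop where
  cont : ContinuousOn (fun q : ℝ × Vec n => u q.1 q.2) (strip n T)
  terminal : ∀ x, c.phi x ≤ u T x
  jet : ∀ (t : ℝ) (x : Vec n), 0 < t → t < T → ∀ (p : ℝ) (q : Vec n)
    (X : Matrix (Fin n) (Fin n) ℝ), (p, q, X) ∈ subjet u t x →
      0 ≤ min (u t x - c.S t x) (-p - c.Fbar x (u t x) q X)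

/-- Viscosity solutions of the averaged obstacle problem. -/
def Coefficients.IsViscositySolution (c : Coefficients n d) (T : ℝ) (u : ℝ → Vec n → ℝ) : Prop :=
  c.IsViscositySubsolution T u ∧ c.IsViscositySupersolution T u

/-- At most polynomial growth in `x`, uniformly for `t ∈ [0,T]`. -/
def PolynomialGrowth (T : ℝ) (u : ℝ → Vec n → ℝ) : Prop :=
  ∃ (C : ℝ) (k : ℕ), ∀ t : ℝ, 0 ≤ t → t ≤ T → ∀ x : Vec n, |u t x| ≤ C * (1 + ‖x‖ ^ k)

end AveragedObstacle

/-! By symmetry it suffices to show `u ≤ v` for a subsolution `u` and a supersolution `v` at times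
`t > 0` (`comparison`); time `0` follows by continuity.

Suppose `u > v` somewhere, and let `χ = exp(lam (T - t)) ((1 + |x|²)^(k+1) + 1/t)`. As `χ` blows up
at `t = 0` and outgrows `u - v` at infinity, while `u ≤ v` at time `T`, some `δ χ` with `δ > 0`
touches `u - v` from above on a compact cylinder, at interior points only
(`exists_penalty_contact`). Doubling time and space together gives jets of `u - δ χ` and of `v` at
nearby points, with ordered second order parts (`exists_jets_of_doubling`). In the limit `u = v + δ
χ > v ≥ S`, so the obstacle is inactive for `u` and the two equations can be subtracted. Since
`Fbar` does not depend on time, doubling the time variable costs nothing.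

The nonlinearity `F` obeys a structure condition uniform in time (`F_sub_le`), which survives
averaging (`Fbar_sub_le`). The time derivative of `χ` gains `lam χ`, whereas its space derivatives
cost at most `B χ` with `B` independent of `lam` (`exists_mem_superjet_penalty`). The limit
inequality `lam δ χ ≤ C (B + 1) δ χ` fails for `lam = C (B + 1) + 1`.

The theorem on sums rests on `exists_second_order_expansion`, which plays the role of the theorems
of Alexandrov and Jensen: the slopes at contact points form a Lipschitz map whose image contains a
ball, so the contact set has positive measure, and Rademacher's theorem together with Lebesgue
density yields a contact point with a second order expansion. -/

namespace AveragedObstacle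

/-! ### Second order expansions of semiconvex functions at contact points. -/

section SecondOrder

open scoped RealInnerProductSpace

variable {E : Type*} [NormedAddCommGroup E] [InnerProductSpace ℝ E]

/-- `W` is touched at `z` from below by a paraboloid of opening `lam` and from above by an affine
function, both with gradient `P`. -/
def IsContact (W : E → ℝ) (lam : ℝ) (z P : E) : Prop :=
  ∀ h, W z + ⟪P, h⟫ - lam / 2 * ‖h‖ ^ 2 ≤ W (z + h) ∧ W (z + h) ≤ W z + ⟪P, h⟫

lemma eq_zero_of_inner_le_sq {lam : ℝ} {a : E} (h : ∀ x, ⟪a, x⟫ ≤ lam * ‖x‖ ^ 2) : a = 0 := by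
  by_contra ha
  have hpos : 0 < ‖a‖ ^ 2 := by positivity
  have h1 : ∀ t : ℝ, 0 < t → 1 ≤ lam * t := by
    intro t ht
    have := h (t • a)
    rw [inner_smul_right, real_inner_self_eq_norm_sq, norm_smul, mul_pow, Real.norm_eq_abs,
      sq_abs] at this
    have h2 : (t * ‖a‖ ^ 2) * 1 ≤ (t * ‖a‖ ^ 2) * (lam * t) := by linarith
    exact le_of_mul_le_mul_left h2 (by positivity)
  have h3 := h1 (1 / (2 * (|lam| + 1))) (by positivity)
  have h4 : lam * (1 / (2 * (|lam| + 1))) ≤ 1 / 2 := by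
    rw [mul_one_div, div_le_div_iff₀ (by positivity) (by norm_num)]
    linarith [le_abs_self lam]
  linarith

/-- The lower and the upper slope agree because a linear form dominated by a quadratic one vanishes.
-/
lemma isContact_of_touching {W : E → ℝ} {lam : ℝ} {z P : E}
    (hlow : ∃ p, ∀ h, W z + ⟪p, h⟫ - lam / 2 * ‖h‖ ^ 2 ≤ W (z + h))
    (hup : ∀ h, W (z + h) ≤ W z + ⟪P, h⟫) : IsContact W lam z P := by
  obtain ⟨p, hp⟩ := hlow
  have : p - P = 0 := eq_zero_of_inner_le_sq (lam := lam / 2) fun x => by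
    rw [inner_sub_left]; linarith [hp x, hup x]
  rw [sub_eq_zero] at this
  subst this
  exact fun h => ⟨hp h, hup h⟩

/-- Lipschitz dependence of the slope on the contact point; in particular the slope is unique. -/
lemma IsContact.norm_sub_le {W : E → ℝ} {lam : ℝ} {z₁ P₁ z₂ P₂ : E}
    (h₁ : IsContact W lam z₁ P₁) (h₂ : IsContact W lam z₂ P₂) (hlam : 0 ≤ lam) :
    ‖P₂ - P₁‖ ≤ 2 * lam * ‖z₂ - z₁‖ := by
  -- `W (z₁ + h)` is bounded above by the plane at `z₁` and below by the paraboloid at `z₂`; the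
  -- plane at `z₂` bounds `W z₁`.
  have key : ∀ h, ⟪P₂ - P₁, h⟫ ≤ lam / 2 * ‖z₁ - z₂ + h‖ ^ 2 := by
    intro h
    have a := (h₁ h).2
    have b := (h₂ (z₁ - z₂ + h)).1
    have c := (h₂ (z₁ - z₂)).2
    rw [show z₂ + (z₁ - z₂ + h) = z₁ + h by abel, inner_add_right] at b
    rw [show z₂ + (z₁ - z₂) = z₁ by abel] at c
    rw [inner_sub_left]
    linarith
  rcases eq_or_ne z₂ z₁ with hz | hz
  · subst hz
    simp only [sub_self, zero_add] at key
    rw [eq_zero_of_inner_le_sq key]; simp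
  · rcases eq_or_ne P₂ P₁ with hP | hP
    · subst hP; simp; positivity
    have hr : 0 < ‖z₂ - z₁‖ := norm_pos_iff.2 (sub_ne_zero.2 hz)
    have hR : 0 < ‖P₂ - P₁‖ := norm_pos_iff.2 (sub_ne_zero.2 hP)
    set r := ‖z₂ - z₁‖
    set R := ‖P₂ - P₁‖ with hRdef
    -- This `h` points along `P₂ - P₁` and has length `r`, so that the norm on the right is at most
    -- `2 r`.
    have k := key ((r / R) • (P₂ - P₁))
    rw [inner_smul_right, real_inner_self_eq_norm_sq, ← hRdef] at k
    have e1 : r / R * R ^ 2 = r * R := by field_simp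
    have e2 : ‖(r / R) • (P₂ - P₁)‖ = r := by
      rw [norm_smul, Real.norm_of_nonneg (by positivity), ← hRdef]; field_simp
    have e3 : ‖z₁ - z₂ + (r / R) • (P₂ - P₁)‖ ≤ r + r := by
      refine (norm_add_le _ _).trans (le_of_eq ?_)
      rw [e2, norm_sub_rev]
    have e4 : ‖z₁ - z₂ + (r / R) • (P₂ - P₁)‖ ^ 2 ≤ (r + r) ^ 2 := by gcongr
    rw [e1] at k
    have : r * R ≤ r * (2 * lam * r) := by
      calc r * R ≤ lam / 2 * (r + r) ^ 2 := k.trans (by gcongr)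
        _ = _ := by ring
    exact le_of_mul_le_mul_left this hr

/-- Neither endpoint has to be a contact point: increments near a contact point are given by its
slope up to a quadratic error. -/
lemma IsContact.abs_increment_le {W : E → ℝ} {lam : ℝ} {z P : E}
    (hz : IsContact W lam z P) (hlam : 0 ≤ lam) (y y' : E) :
    |W y' - W y - ⟪P, y' - y⟫| ≤ lam / 2 * (‖y' - z‖ ^ 2 + ‖y - z‖ ^ 2) := by
  have a := hz (y - z)
  have b := hz (y' - z)
  rw [add_sub_cancel] at a b
  have e : ⟪P, y' - y⟫ = ⟪P, y' - z⟫ - ⟪P, y - z⟫ := by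
    rw [← inner_sub_right]; congr 1; abel
  have p1 : 0 ≤ lam / 2 * ‖y' - z‖ ^ 2 := by positivity
  have p2 : 0 ≤ lam / 2 * ‖y - z‖ ^ 2 := by positivity
  rw [e, abs_le]
  constructor <;> linarith [a.1, a.2, b.1, b.2]

/-- The segment from `z` to `z + h` is cut into `m` steps. The increment over each step is read off
from a contact point near its initial node, whose slope is close to `P + (i / m) A h`; these slopes
form a Riemann sum for the quadratic term. Thus first order information on the slopes becomes second
order information on `W`. -/
lemma abs_increment_sub_quadratic_le {W : E → ℝ} {lam : ℝ} (hlam : 0 ≤ lam) {z P h : E}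
    (A : E →L[ℝ] E) {m : ℕ} (hm : 0 < m) {ε : ℝ}
    (hpts : ∀ i : ℕ, i < m → ∃ w Q, IsContact W lam w Q ∧
      ‖w - (z + ((i : ℝ) / m) • h)‖ ≤ ‖h‖ / m ∧ ‖Q - P - A (w - z)‖ ≤ ε * ‖h‖) :
    |W (z + h) - W z - ⟪P, h⟫ - 1 / 2 * ⟪A h, h⟫|
      ≤ (ε + (2 * ‖A‖ + 3 * lam) / m) * ‖h‖ ^ 2 := by
  have hm' : (0 : ℝ) < m := by exact_mod_cast hm
  set y : ℕ → E := fun i => z + ((i : ℝ) / m) • h with hy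
  have hyd : ∀ i, y (i + 1) - y i = (1 / (m : ℝ)) • h := by
    intro i
    simp only [hy]
    rw [add_sub_add_left_eq_sub, ← sub_smul]
    congr 1
    push_cast; field_simp; ring
  set T : ℕ → ℝ := fun i => W (y (i + 1)) - W (y i) - ⟪P + ((i : ℝ) / m) • A h, (1 / (m : ℝ)) • h⟫
    with hT
  have hstep : ∀ i ∈ Finset.range m, |T i| ≤ (ε + (‖A‖ + 5 / 2 * lam) / m) * ‖h‖ ^ 2 / m := by
    intro i hi
    obtain ⟨w, Q, hw, hwd, hQ⟩ := hpts i (Finset.mem_range.1 hi)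
    have h1 := hw.abs_increment_le hlam (y i) (y (i + 1))
    have h2 : ‖y i - w‖ ≤ ‖h‖ / m := by rw [norm_sub_rev]; exact hwd
    have h3 : ‖y (i + 1) - w‖ ≤ 2 * (‖h‖ / m) := by
      calc ‖y (i + 1) - w‖ = ‖(y (i + 1) - y i) + (y i - w)‖ := by congr 1; abel
        _ ≤ ‖y (i + 1) - y i‖ + ‖y i - w‖ := norm_add_le _ _
        _ ≤ ‖h‖ / m + ‖h‖ / m := by
          gcongr
          rw [hyd, norm_smul, Real.norm_of_nonneg (by positivity)]
          exact le_of_eq (by ring)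
        _ = _ := by ring
    have h4 : ‖Q - (P + ((i : ℝ) / m) • A h)‖ ≤ ε * ‖h‖ + ‖A‖ * (‖h‖ / m) := by
      have : Q - (P + ((i : ℝ) / m) • A h) = (Q - P - A (w - z)) + A (w - y i) := by
        have : w - y i = (w - z) - ((i : ℝ) / m) • h := by simp only [hy]; abel
        rw [this, map_sub A (w - z), map_smul]; abel
      rw [this]
      refine (norm_add_le _ _).trans (add_le_add hQ ((A.le_opNorm _).trans ?_))
      gcongr
    rw [hyd] at h1
    have h5 : |⟪Q - (P + ((i : ℝ) / m) • A h), (1 / (m : ℝ)) • h⟫|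
        ≤ (ε * ‖h‖ + ‖A‖ * (‖h‖ / m)) * (‖h‖ / m) := by
      refine (abs_real_inner_le_norm _ _).trans ?_
      have : ‖(1 / (m : ℝ)) • h‖ = ‖h‖ / m := by
        rw [norm_smul, Real.norm_of_nonneg (by positivity)]; ring
      rw [this]; gcongr
    have h6 : lam / 2 * (‖y (i + 1) - w‖ ^ 2 + ‖y i - w‖ ^ 2)
        ≤ lam / 2 * ((2 * (‖h‖ / m)) ^ 2 + (‖h‖ / m) ^ 2) := by gcongr
    have h7 : T i = (W (y (i + 1)) - W (y i) - ⟪Q, (1 / (m : ℝ)) • h⟫)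
        + ⟪Q - (P + ((i : ℝ) / m) • A h), (1 / (m : ℝ)) • h⟫ := by
      rw [inner_sub_left]; simp only [hT]; ring
    rw [h7]
    refine (abs_add_le _ _).trans ((add_le_add (h1.trans h6) h5).trans (le_of_eq ?_))
    field_simp
    ring
  -- The left Riemann sum of the identity on `[0,1]` is `1/2 - 1/(2m)`; the defect is part of the
  -- `O(1/m)` error.
  have hsum : ∑ i ∈ Finset.range m, T i
      = W (z + h) - W z - ⟪P, h⟫ - (1 / 2 - 1 / (2 * m)) * ⟪A h, h⟫ := by
    have e1 : ∑ i ∈ Finset.range m, (W (y (i + 1)) - W (y i)) = W (z + h) - W z := by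
      rw [Finset.sum_range_sub (fun i => W (y i))]
      simp [hy, div_self hm'.ne']
    have e2 : ∀ i, T i = (W (y (i + 1)) - W (y i)) - (1 / (m : ℝ)) * ⟪P, h⟫
        - (i : ℝ) * (1 / (m : ℝ) ^ 2 * ⟪A h, h⟫) := by
      intro i
      simp only [hT, inner_smul_right, inner_add_left, real_inner_smul_left]
      field_simp
      ring
    have e3 : (∑ i ∈ Finset.range m, (i : ℝ)) = m * (m - 1) / 2 := by
      have := Finset.sum_range_id_mul_two m
      have h2 : ((∑ i ∈ Finset.range m, i : ℕ) : ℝ) * 2 = m * (m - 1) := by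
        rw [← Nat.cast_pred hm]; exact_mod_cast this
      push_cast at h2; linarith
    simp only [e2, Finset.sum_sub_distrib, e1, ← Finset.sum_mul, e3, Finset.sum_const,
      Finset.card_range, nsmul_eq_mul]
    field_simp
  have hbound : |∑ i ∈ Finset.range m, T i| ≤ (ε + (‖A‖ + 5 / 2 * lam) / m) * ‖h‖ ^ 2 := by
    refine (Finset.abs_sum_le_sum_abs _ _).trans ((Finset.sum_le_sum hstep).trans (le_of_eq ?_))
    rw [Finset.sum_const, Finset.card_range, nsmul_eq_mul]
    field_simp
  have hA : |⟪A h, h⟫| ≤ ‖A‖ * ‖h‖ ^ 2 := by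
    refine (abs_real_inner_le_norm _ _).trans ?_
    calc ‖A h‖ * ‖h‖ ≤ ‖A‖ * ‖h‖ * ‖h‖ := by gcongr; exact A.le_opNorm h
      _ = _ := by ring
  have heq : W (z + h) - W z - ⟪P, h⟫ - 1 / 2 * ⟪A h, h⟫
      = ∑ i ∈ Finset.range m, T i - 1 / (2 * m) * ⟪A h, h⟫ := by rw [hsum]; ring
  rw [heq]
  have hA' : |1 / (2 * (m : ℝ)) * ⟪A h, h⟫| ≤ 1 / (2 * m) * (‖A‖ * ‖h‖ ^ 2) := by
    rw [abs_mul, abs_of_nonneg (by positivity : (0 : ℝ) ≤ 1 / (2 * m))]; gcongr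
  refine (abs_sub _ _).trans ((add_le_add hbound hA').trans ?_)
  have : (ε + (2 * ‖A‖ + 3 * lam) / m) * ‖h‖ ^ 2 -
      ((ε + (‖A‖ + 5 / 2 * lam) / m) * ‖h‖ ^ 2 + 1 / (2 * m) * (‖A‖ * ‖h‖ ^ 2))
      = (‖A‖ + lam) / (2 * m) * ‖h‖ ^ 2 := by field_simp; ring
  have h0 : 0 ≤ (‖A‖ + lam) / (2 * m) * ‖h‖ ^ 2 := by positivity
  linarith

/-- At a density point of a set, every nearby point is close to the set, relative to its distance
to the density point. -/
lemma ae_restrict_exists_close [FiniteDimensional ℝ E] [MeasurableSpace E] [BorelSpace E]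
    (μ : MeasureTheory.Measure E) [μ.IsAddHaarMeasure] (S : Set E) :
    ∀ᵐ z ∂(μ.restrict S), ∀ ε : ℝ, 0 < ε →
      ∀ᶠ y in 𝓝 z, y ≠ z → ∃ w ∈ S, ‖w - y‖ ≤ ε * ‖y - z‖ := by
  have H : ∀ᵐ z ∂(μ.restrict S), ∀ k : ℕ, ∀ (w : E → E) (δ : E → ℝ),
      Tendsto δ (𝓝[≠] z) (𝓝[>] 0) →
      (∀ᶠ j in 𝓝[≠] z, z ∈ Metric.closedBall (w j) (((k : ℝ) + 1) * δ j)) →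
      Tendsto (fun j => μ (S ∩ Metric.closedBall (w j) (δ j)) / μ (Metric.closedBall (w j) (δ j)))
        (𝓝[≠] z) (𝓝 1) := by
    rw [MeasureTheory.ae_all_iff]
    intro k
    filter_upwards [IsUnifLocDoublingMeasure.ae_tendsto_measure_inter_div μ S ((k : ℝ) + 1)]
      with z hz w δ h1 h2
    exact hz w δ h1 h2
  filter_upwards [H] with z hz ε hε
  obtain ⟨k, hk⟩ := exists_nat_gt (1 / ε)
  have hk0 : (0 : ℝ) < k + 1 := by positivity
  have hkε : 1 / ((k : ℝ) + 1) ≤ ε := by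
    rw [div_le_iff₀ hk0]
    rw [div_lt_iff₀ hε] at hk
    nlinarith
  -- The density theorem is applied to balls centred at `y`, not at `z`: with radius `‖y - z‖ / (k +
  -- 1)`, their dilates by `k + 1` still contain `z`. A ball meeting `S` in positive measure
  -- contains the wanted point.
  have h1 : Tendsto (fun y : E => 1 / ((k : ℝ) + 1) * ‖y - z‖) (𝓝[≠] z) (𝓝[>] 0) := by
    refine tendsto_nhdsWithin_iff.2 ⟨?_, ?_⟩
    · have : Continuous fun y : E => 1 / ((k : ℝ) + 1) * ‖y - z‖ := by fun_prop
      have := (this.tendsto z).mono_left (nhdsWithin_le_nhds (s := {z}ᶜ))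
      simpa using this
    · filter_upwards [self_mem_nhdsWithin] with y hy
      have : 0 < ‖y - z‖ := norm_pos_iff.2 (sub_ne_zero.2 hy)
      exact Set.mem_Ioi.2 (by positivity)
  have h2 := hz k id _ h1 (Eventually.of_forall fun y => by
    rw [Metric.mem_closedBall, dist_eq_norm, id, norm_sub_rev]
    exact le_of_eq (by field_simp))
  have h3 := h2.eventually (lt_mem_nhds (zero_lt_one))
  rw [eventually_nhdsWithin_iff] at h3
  filter_upwards [h3] with y hy hyz
  have h4 := hy hyz
  have h5 : μ (S ∩ Metric.closedBall (id y) (1 / ((k : ℝ) + 1) * ‖y - z‖)) ≠ 0 := by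
    intro h0; rw [h0] at h4; simp at h4
  obtain ⟨w, hwS, hw⟩ := MeasureTheory.nonempty_of_measure_ne_zero h5
  refine ⟨w, hwS, ?_⟩
  rw [Metric.mem_closedBall, dist_eq_norm] at hw
  exact hw.trans (by gcongr)

/-- A semiconvex function all of whose small linear perturbations attain their maximum has a second
order expansion at the maximum point of one of these perturbations. -/
theorem exists_second_order_expansion [FiniteDimensional ℝ E] {W : E → ℝ} {lam δ : ℝ}
    (hlam : 0 ≤ lam) (hδ : 0 < δ)
    (hlow : ∀ z, ∃ p, ∀ h, W z + ⟪p, h⟫ - lam / 2 * ‖h‖ ^ 2 ≤ W (z + h))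
    (hmax : ∀ P : E, ‖P‖ ≤ δ → ∃ z, ∀ h, W (z + h) ≤ W z + ⟪P, h⟫) :
    ∃ (z P : E) (A : E →L[ℝ] E), ‖P‖ ≤ δ ∧ (∀ h, W (z + h) ≤ W z + ⟪P, h⟫) ∧
      ∀ ε : ℝ, 0 < ε → ∀ᶠ h in 𝓝 (0 : E),
        |W (z + h) - W z - ⟪P, h⟫ - 1 / 2 * ⟪A h, h⟫| ≤ ε * ‖h‖ ^ 2 := by
  classical
  let _ : MeasurableSpace E := borel E
  have : BorelSpace E := ⟨rfl⟩
  -- In this dimension Hausdorff measure is a Haar measure, and it is directly controlled under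
  -- Lipschitz maps.
  let μ : MeasureTheory.Measure E := MeasureTheory.Measure.hausdorffMeasure (Module.finrank ℝ E)
  set S : Set E := {z | ∃ P, ‖P‖ ≤ δ ∧ IsContact W lam z P} with hS
  have hex : ∀ z : E, ∃ P, z ∈ S → ‖P‖ ≤ δ ∧ IsContact W lam z P := by
    intro z
    by_cases hz : z ∈ S
    · obtain ⟨P, hP⟩ := hz; exact ⟨P, fun _ => hP⟩
    · exact ⟨0, fun h => absurd h hz⟩
  choose grad hgrad using hex
  have hlip : LipschitzOnWith (2 * lam).toNNReal grad S := by
    refine LipschitzOnWith.of_dist_le_mul fun x hx y hy => ?_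
    rw [dist_eq_norm, dist_eq_norm, Real.coe_toNNReal _ (by positivity)]
    exact (hgrad y hy).2.norm_sub_le (hgrad x hx).2 hlam
  -- Every small slope is realised by some maximum point. A Lipschitz image of a null set is null,
  -- so `S` cannot be null.
  have himage : Metric.closedBall (0 : E) δ ⊆ grad '' S := by
    intro P hP
    rw [mem_closedBall_zero_iff] at hP
    obtain ⟨z, hz⟩ := hmax P hP
    have hc := isContact_of_touching (hlow z) hz
    have hzS : z ∈ S := ⟨P, hP, hc⟩
    refine ⟨z, hzS, ?_⟩
    have := hc.norm_sub_le (hgrad z hzS).2 hlam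
    simp only [sub_self, norm_zero, mul_zero] at this
    exact sub_eq_zero.1 (norm_le_zero_iff.1 this)
  have hpos : μ S ≠ 0 := by
    intro h0
    have h1 := hlip.hausdorffMeasure_image_le (d := Module.finrank ℝ E) (by positivity)
    have h2 : 0 < μ (Metric.closedBall (0 : E) δ) := Metric.measure_closedBall_pos _ _ hδ
    have h3 := (MeasureTheory.measure_mono (μ := μ) himage).trans h1
    change _ ≤ _ * μ S at h3
    rw [h0, mul_zero] at h3
    exact absurd h3 (not_le.2 h2)
  -- Rademacher's theorem needs a map on the whole space; only its values on `S` are slopes of `W`.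
  obtain ⟨ext, hextlip, hext⟩ := hlip.extend_finite_dimension
  have hae : ∀ᵐ z ∂(μ.restrict S), DifferentiableAt ℝ ext z ∧ ∀ ε : ℝ, 0 < ε →
      ∀ᶠ y in 𝓝 z, y ≠ z → ∃ w ∈ S, ‖w - y‖ ≤ ε * ‖y - z‖ :=
    (MeasureTheory.ae_restrict_of_ae hextlip.ae_differentiableAt).and
      (ae_restrict_exists_close μ S)
  obtain ⟨z, hzS, hdiff, hdens⟩ : ∃ z ∈ S, DifferentiableAt ℝ ext z ∧ ∀ ε : ℝ, 0 < ε →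
      ∀ᶠ y in 𝓝 z, y ≠ z → ∃ w ∈ S, ‖w - y‖ ≤ ε * ‖y - z‖ := by
    by_contra hne
    push Not at hne
    rw [MeasureTheory.ae_iff] at hae
    refine hpos (le_antisymm ?_ (zero_le))
    rw [← hae]
    refine le_trans (MeasureTheory.measure_mono ?_) (MeasureTheory.Measure.le_restrict_apply _ _)
    intro w hw
    refine ⟨?_, hw⟩
    intro hcon
    obtain ⟨ε, hε, hf⟩ := hne w hw hcon.1
    exact hf (by simpa using hcon.2 ε hε)
  refine ⟨z, grad z, fderiv ℝ ext z, (hgrad z hzS).1, fun h => ((hgrad z hzS).2 h).2, ?_⟩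
  intro ε hε
  set A := fderiv ℝ ext z
  -- The number of steps is fixed first, to absorb the discretisation error; density at scale `1 /
  -- m` and differentiability then determine how small `h` must be.
  obtain ⟨m, hm⟩ := exists_nat_gt ((2 * ‖A‖ + 3 * lam) / (ε / 2))
  have hm0 : (0 : ℝ) < m := lt_of_le_of_lt (by positivity) hm
  have hmε : (2 * ‖A‖ + 3 * lam) / m ≤ ε / 2 := by
    rw [div_lt_iff₀ (by positivity)] at hm
    rw [div_le_iff₀ hm0]; linarith
  have hd := hdiff.hasFDerivAt.isLittleO
  have hd' := hd.def (show (0 : ℝ) < ε / 4 by positivity)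
  obtain ⟨r₁, hr₁, H₁⟩ := Metric.eventually_nhds_iff.1 hd'
  obtain ⟨r₂, hr₂, H₂⟩ := Metric.eventually_nhds_iff.1 (hdens (1 / m) (by positivity))
  have hnear : ∀ᶠ h in 𝓝 (0 : E), ‖h‖ < min (r₁ / 2) r₂ := by
    have : Tendsto (fun h : E => ‖h‖) (𝓝 0) (𝓝 0) := tendsto_norm_zero
    exact this.eventually (gt_mem_nhds (by positivity))
  filter_upwards [hnear] with h hh
  have hh1 : ‖h‖ < r₁ / 2 := hh.trans_le (min_le_left _ _)
  have hh2 : ‖h‖ < r₂ := hh.trans_le (min_le_right _ _)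
  refine (abs_increment_sub_quadratic_le (ε := ε / 2) hlam A (Nat.cast_pos.1 hm0) ?_).trans ?_
  · intro i hi
    have him : (i : ℝ) / m ≤ 1 := by
      rw [div_le_one hm0]; exact_mod_cast hi.le
    have hi0 : (0 : ℝ) ≤ (i : ℝ) / m := by positivity
    set y := z + ((i : ℝ) / m) • h with hy
    have hyz : ‖y - z‖ ≤ ‖h‖ := by
      rw [hy, add_sub_cancel_left, norm_smul, Real.norm_of_nonneg hi0]
      exact mul_le_of_le_one_left (norm_nonneg _) him
    obtain ⟨w, hwS, hw⟩ : ∃ w ∈ S, ‖w - y‖ ≤ ‖h‖ / m := by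
      by_cases hne : y = z
      · exact ⟨z, hzS, by rw [hne, sub_self, norm_zero]; positivity⟩
      · obtain ⟨w, hw, hwy⟩ := H₂ (by rw [dist_eq_norm]; exact hyz.trans_lt hh2) hne
        refine ⟨w, hw, hwy.trans ?_⟩
        rw [one_div_mul_eq_div]; gcongr
    have hwz : ‖w - z‖ ≤ 2 * ‖h‖ := by
      have : ‖h‖ / m ≤ ‖h‖ := div_le_self (norm_nonneg _) (by
        exact_mod_cast (Nat.cast_pos.1 hm0 : 0 < m))
      calc ‖w - z‖ = ‖(w - y) + (y - z)‖ := by congr 1; abel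
        _ ≤ ‖w - y‖ + ‖y - z‖ := norm_add_le _ _
        _ ≤ _ := by linarith
    refine ⟨w, grad w, (hgrad w hwS).2, hw, ?_⟩
    have := H₁ (show dist w z < r₁ by rw [dist_eq_norm]; linarith)
    rw [← hext hwS, ← hext hzS] at this
    calc ‖grad w - grad z - A (w - z)‖ ≤ ε / 4 * ‖w - z‖ := this
      _ ≤ ε / 4 * (2 * ‖h‖) := by gcongr
      _ = _ := by ring
  · have : ε / 2 + (2 * ‖A‖ + 3 * lam) / m ≤ ε := by linarith
    gcongr

end SecondOrder

/-! ### Sup-convolutions and the theorem on sums. -/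

section Sums

open scoped RealInnerProductSpace

variable {E : Type*} [NormedAddCommGroup E]

/-- The sup-convolution of the restriction of `U` to `K` with `-β/2 |·|²`. -/
noncomputable def supConv (K : Set E) (β : ℝ) (U : E → ℝ) (z : E) : ℝ :=
  sSup ((fun w => U w - β / 2 * ‖z - w‖ ^ 2) '' K)

lemma exists_supConv_eq {K : Set E} (hK : IsCompact K) (hne : K.Nonempty) (β : ℝ) {U : E → ℝ}
    (hU : ContinuousOn U K) (z : E) :
    ∃ w ∈ K, supConv K β U z = U w - β / 2 * ‖z - w‖ ^ 2 :=
  hK.exists_sSup_image_eq hne (hU.sub (by fun_prop))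

lemma le_supConv {K : Set E} (hK : IsCompact K) (β : ℝ) {U : E → ℝ}
    (hU : ContinuousOn U K) (z : E) {w : E} (hw : w ∈ K) :
    U w - β / 2 * ‖z - w‖ ^ 2 ≤ supConv K β U z :=
  le_csSup (hK.bddAbove_image (hU.sub (by fun_prop))) ⟨w, hw, rfl⟩

lemma norm_sub_sq_le_three (a b c d : E) :
    ‖a - b‖ ^ 2 ≤ 3 * (‖c - a‖ ^ 2 + ‖d - b‖ ^ 2 + ‖c - d‖ ^ 2) := by
  have h : ‖a - b‖ ≤ ‖c - a‖ + ‖c - d‖ + ‖d - b‖ := by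
    calc ‖a - b‖ = ‖-(c - a) + (c - d) + (d - b)‖ := by congr 1; abel
      _ ≤ ‖-(c - a)‖ + ‖c - d‖ + ‖d - b‖ := norm_add₃_le
      _ = _ := by rw [norm_neg]
  have h2 : ‖a - b‖ ^ 2 ≤ (‖c - a‖ + ‖c - d‖ + ‖d - b‖) ^ 2 := by gcongr
  nlinarith [sq_nonneg (‖c - a‖ - ‖c - d‖), sq_nonneg (‖c - a‖ - ‖d - b‖),
    sq_nonneg (‖c - d‖ - ‖d - b‖)]

variable [InnerProductSpace ℝ E]

/-- Freezing the maximiser `w` for `z` leaves a concave paraboloid in `h` below the supremum. -/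
lemma supConv_lower_paraboloid {K : Set E} (hK : IsCompact K) (hne : K.Nonempty) (β : ℝ)
    {U : E → ℝ} (hU : ContinuousOn U K) (z : E) :
    ∃ p, ∀ h, supConv K β U z + ⟪p, h⟫ - β / 2 * ‖h‖ ^ 2 ≤ supConv K β U (z + h) := by
  obtain ⟨w, hw, he⟩ := exists_supConv_eq hK hne β hU z
  refine ⟨-(β • (z - w)), fun h => ?_⟩
  have := le_supConv hK β hU (z + h) hw
  rw [show z + h - w = (z - w) + h by abel, norm_add_sq_real] at this
  rw [inner_neg_left, real_inner_smul_left]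
  linarith

/-- The regularised difference of two functions, with a quadratic penalty. -/
noncomputable def doubled (K : Set E) (α : ℝ) (U V : E → ℝ) (z : WithLp 2 (E × E)) : ℝ :=
  supConv K α U z.fst + supConv K α V z.snd - α / 2 * ‖z.fst - z.snd‖ ^ 2

lemma norm_sub_sq_le (a b : E) : ‖a - b‖ ^ 2 ≤ 2 * ‖a‖ ^ 2 + 2 * ‖b‖ ^ 2 := by
  have := parallelogram_law_with_norm ℝ a b
  nlinarith [mul_self_nonneg ‖a + b‖]

/-- The opening is `3 α`: the sup-convolutions contribute `α`, and the penalty at most `2 α` because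
`‖a - b‖² ≤ 2‖a‖² + 2‖b‖²`. -/
lemma doubled_lower_paraboloid {K : Set E} (hK : IsCompact K) (hne : K.Nonempty) {α : ℝ}
    (hα : 0 < α) {U V : E → ℝ} (hU : ContinuousOn U K) (hV : ContinuousOn V K)
    (z : WithLp 2 (E × E)) :
    ∃ p, ∀ h, doubled K α U V z + ⟪p, h⟫ - (3 * α) / 2 * ‖h‖ ^ 2 ≤ doubled K α U V (z + h) := by
  obtain ⟨p, hp⟩ := supConv_lower_paraboloid hK hne α hU z.fst
  obtain ⟨q, hq⟩ := supConv_lower_paraboloid hK hne α hV z.snd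
  refine ⟨WithLp.toLp 2 (p - α • (z.fst - z.snd), q + α • (z.fst - z.snd)), fun h => ?_⟩
  have h1 := hp h.fst
  have h2 := hq h.snd
  simp only [doubled, WithLp.prod_inner_apply, WithLp.prod_norm_sq_eq_of_L2, WithLp.add_fst,
    WithLp.add_snd, WithLp.ofLp_fst, WithLp.ofLp_snd,
    inner_sub_left (𝕜 := ℝ) p,
    inner_add_left (𝕜 := ℝ) q, real_inner_smul_left]
  rw [show z.fst + h.fst - (z.snd + h.snd) = (z.fst - z.snd) + (h.fst - h.snd) by abel,
    norm_add_sq_real, inner_sub_right]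
  have h3 : α / 2 * ‖h.fst - h.snd‖ ^ 2 ≤ α / 2 * (2 * ‖h.fst‖ ^ 2 + 2 * ‖h.snd‖ ^ 2) := by
    gcongr; exact norm_sub_sq_le _ _
  linarith

/-- The maximum of a linearly perturbed regularised difference is attained in a fixed ball. -/
lemma exists_radius_doubled_max [FiniteDimensional ℝ E] {K : Set E} (hK : IsCompact K)
    (hne : K.Nonempty) {α : ℝ} (hα : 0 < α) {U V : E → ℝ} (hU : ContinuousOn U K)
    (hV : ContinuousOn V K) :
    ∃ R : ℝ, 0 < R ∧ (∀ y ∈ K, ‖(WithLp.toLp 2 (y, y) : WithLp 2 (E × E))‖ ≤ R) ∧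
      (∀ P : WithLp 2 (E × E), ‖P‖ ≤ 1 →
        ∃ z, ∀ h, doubled K α U V (z + h) ≤ doubled K α U V z + ⟪P, h⟫) ∧
      ∀ P z : WithLp 2 (E × E), ‖P‖ ≤ 1 →
        (∀ h, doubled K α U V (z + h) ≤ doubled K α U V z + ⟪P, h⟫) → ‖z‖ ≤ R := by
  obtain ⟨ρ, hρ0, hρ⟩ : ∃ ρ : ℝ, 0 < ρ ∧ ∀ w ∈ K, ‖w‖ ≤ ρ := by
    obtain ⟨ρ, hρ⟩ := hK.isBounded.exists_norm_le
    exact ⟨max ρ 1, by positivity, fun w hw => (hρ w hw).trans (le_max_left _ _)⟩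
  have hpair : ∀ a ∈ K, ∀ b ∈ K, ‖(WithLp.toLp 2 (a, b) : WithLp 2 (E × E))‖ ≤ 2 * ρ := by
    intro a ha b hb
    have h1 := hρ a ha
    have h2 := hρ b hb
    refine abs_le_of_sq_le_sq' ?_ (by positivity) |>.2
    rw [WithLp.prod_norm_sq_eq_of_L2, WithLp.toLp_fst, WithLp.toLp_snd]
    nlinarith [norm_nonneg a, norm_nonneg b]
  -- The perturbed function before the two suprema are taken; maximising it jointly in `(z, a, b)`
  -- avoids any continuity statement for sup-convolutions.
  let Ψ : WithLp 2 (E × E) → WithLp 2 (E × E) → E → E → ℝ := fun P z a b =>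
    (U a - α / 2 * ‖z.fst - a‖ ^ 2) + (V b - α / 2 * ‖z.snd - b‖ ^ 2)
      - α / 2 * ‖z.fst - z.snd‖ ^ 2 - ⟪P, z⟫
  have hΨle : ∀ P z, ∀ a ∈ K, ∀ b ∈ K, Ψ P z a b ≤ doubled K α U V z - ⟪P, z⟫ := by
    intro P z a ha b hb
    have h1 := le_supConv hK α hU z.fst ha
    have h2 := le_supConv hK α hV z.snd hb
    simp only [Ψ, doubled]; linarith
  have hΨeq : ∀ z, ∃ a ∈ K, ∃ b ∈ K, ∀ P, Ψ P z a b = doubled K α U V z - ⟪P, z⟫ := by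
    intro z
    obtain ⟨a, ha, h1⟩ := exists_supConv_eq hK hne α hU z.fst
    obtain ⟨b, hb, h2⟩ := exists_supConv_eq hK hne α hV z.snd
    exact ⟨a, ha, b, hb, fun P => by simp only [Ψ, doubled, h1, h2]⟩
  -- Beyond this radius, replacing `z` by `(a, b)` gains `α/2 s²`, where `s` is the distance moved.
  -- It loses at most `s < α/4 s²` from the linear term and `2 α ρ² ≤ α/4 s²` from the penalty.
  set R := 2 * ρ + (4 / α + 3 * ρ) with hR
  have hfar : ∀ P z : WithLp 2 (E × E), ‖P‖ ≤ 1 → R < ‖z‖ → ∀ a ∈ K, ∀ b ∈ K,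
      Ψ P z a b < Ψ P (WithLp.toLp 2 (a, b)) a b := by
    intro P z hP hz a ha b hb
    set w : WithLp 2 (E × E) := WithLp.toLp 2 (a, b) with hw
    have hwn : ‖w‖ ≤ 2 * ρ := hpair a ha b hb
    set s := ‖z - w‖ with hs
    have hs1 : 4 / α + 3 * ρ < s := by
      have := norm_sub_norm_le z w
      linarith
    have hs2 : s ^ 2 = ‖z.fst - a‖ ^ 2 + ‖z.snd - b‖ ^ 2 := by
      rw [hs, WithLp.prod_norm_sq_eq_of_L2]; rfl
    have h4 : 0 < 4 / α := by positivity
    have hs0 : 0 < s := by linarith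
    have hs3 : s < α / 4 * s ^ 2 := by
      have : 1 < α / 4 * s := by
        have : 4 / α < s := by linarith
        rw [div_lt_iff₀ hα] at this; linarith
      nlinarith
    have hs4 : 2 * α * ρ ^ 2 ≤ α / 4 * s ^ 2 := by
      have : (3 * ρ) ^ 2 ≤ s ^ 2 := by gcongr; linarith
      nlinarith
    have hab : ‖a - b‖ ^ 2 ≤ 4 * ρ ^ 2 := by
      have h1 : ‖a‖ ^ 2 ≤ ρ ^ 2 := by gcongr; exact hρ a ha
      have h2 : ‖b‖ ^ 2 ≤ ρ ^ 2 := by gcongr; exact hρ b hb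
      linarith [norm_sub_sq_le a b]
    have hPs : ⟪P, w⟫ - ⟪P, z⟫ ≤ s := by
      rw [← inner_sub_right]
      refine (real_inner_le_norm _ _).trans ?_
      rw [norm_sub_rev, ← hs]
      exact mul_le_of_le_one_left hs0.le hP
    have hwf : w.fst = a := rfl
    have hws : w.snd = b := rfl
    have hzz : 0 ≤ α / 2 * ‖z.fst - z.snd‖ ^ 2 := by positivity
    simp only [Ψ, hwf, hws, sub_self, norm_zero]
    nlinarith
  refine ⟨R, by positivity, ?_, ?_, ?_⟩
  · intro y hy
    have : 0 < 4 / α := by positivity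
    have := hpair y hy y hy
    linarith
  · intro P hP
    have hc : IsCompact (Metric.closedBall (0 : WithLp 2 (E × E)) R ×ˢ K ×ˢ K) :=
      (isCompact_closedBall _ _).prod (hK.prod hK)
    obtain ⟨w₀, hw₀⟩ := hne
    have hcn : (Metric.closedBall (0 : WithLp 2 (E × E)) R ×ˢ K ×ˢ K).Nonempty :=
      ⟨(0, w₀, w₀), by simp [hw₀]; positivity⟩
    have hcont : ContinuousOn (fun x : WithLp 2 (E × E) × E × E => Ψ P x.1 x.2.1 x.2.2)
        (Metric.closedBall (0 : WithLp 2 (E × E)) R ×ˢ K ×ˢ K) := by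
      have c1 : ContinuousOn (fun x : WithLp 2 (E × E) × E × E => U x.2.1)
          (Metric.closedBall (0 : WithLp 2 (E × E)) R ×ˢ K ×ˢ K) :=
        hU.comp (by fun_prop) fun x hx => hx.2.1
      have c2 : ContinuousOn (fun x : WithLp 2 (E × E) × E × E => V x.2.2)
          (Metric.closedBall (0 : WithLp 2 (E × E)) R ×ˢ K ×ˢ K) :=
        hV.comp (by fun_prop) fun x hx => hx.2.2
      have c3 : Continuous fun x : WithLp 2 (E × E) × E × E => x.1.fst :=
        (WithLp.prod_continuous_ofLp 2 E E).fst.comp continuous_fst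
      have c4 : Continuous fun x : WithLp 2 (E × E) × E × E => x.1.snd :=
        (WithLp.prod_continuous_ofLp 2 E E).snd.comp continuous_fst
      simp only [Ψ]
      refine (((c1.sub ?_).add (c2.sub ?_)).sub ?_).sub ?_ <;>
        exact Continuous.continuousOn (by fun_prop)
    obtain ⟨⟨z, a, b⟩, ⟨hz, ha, hb⟩, hmax⟩ := hc.exists_isMaxOn hcn hcont
    refine ⟨z, fun h => ?_⟩
    have hall : ∀ y, doubled K α U V y - ⟪P, y⟫ ≤ Ψ P z a b := by
      intro y
      obtain ⟨a', ha', b', hb', he⟩ := hΨeq y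
      rw [← he P]
      by_cases hy : ‖y‖ ≤ R
      · exact hmax (show (y, a', b') ∈ _ from ⟨by simpa using hy, ha', hb'⟩)
      · refine (hfar P y hP (not_le.1 hy) a' ha' b' hb').le.trans ?_
        refine hmax (show ((WithLp.toLp 2 (a', b') : WithLp 2 (E × E)), a', b') ∈ _ from
          ⟨?_, ha', hb'⟩)
        rw [mem_closedBall_zero_iff]
        have : 0 < 4 / α := by positivity
        have := hpair a' ha' b' hb'
        linarith
    have h1 := hall (z + h)
    have h2 := hΨle P z a ha b hb
    rw [inner_add_right] at h1
    linarith
  · intro P z hP hz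
    by_contra hcon
    obtain ⟨a, ha, b, hb, he⟩ := hΨeq z
    have h1 := hfar P z hP (not_le.1 hcon) a ha b hb
    have h2 := hΨle P (WithLp.toLp 2 (a, b)) a ha b hb
    have h3 := hz (WithLp.toLp 2 (a, b) - z)
    rw [add_sub_cancel, inner_sub_right] at h3
    linarith [he P]

/-- **Theorem on sums** for a quadratic penalty. -/
theorem exists_jets_of_doubling [FiniteDimensional ℝ E] {K : Set E} (hK : IsCompact K)
    (hne : K.Nonempty) {U V : E → ℝ} (hU : ContinuousOn U K) (hV : ContinuousOn V K)
    {α δ : ℝ} (hα : 0 < α) (hδ : 0 < δ) :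
    ∃ z₁ ∈ K, ∃ z₂ ∈ K, ∃ (e p₁ p₂ : E) (A₁ A₂ : E →L[ℝ] E),
      ‖p₁ - α • e‖ ≤ δ ∧ ‖p₂ - α • e‖ ≤ δ ∧
      (∀ y ∈ K, U y - V y + α / 12 * (‖e‖ ^ 2 + ‖z₁ - z₂‖ ^ 2) ≤ U z₁ - V z₂ + δ) ∧
      (∀ ε : ℝ, 0 < ε → ∀ᶠ h in 𝓝 (0 : E), z₁ + h ∈ K →
        U (z₁ + h) ≤ U z₁ + ⟪p₁, h⟫ + 1 / 2 * ⟪A₁ h, h⟫ + ε * ‖h‖ ^ 2) ∧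
      (∀ ε : ℝ, 0 < ε → ∀ᶠ h in 𝓝 (0 : E), z₂ + h ∈ K →
        V z₂ + ⟪p₂, h⟫ + 1 / 2 * ⟪A₂ h, h⟫ - ε * ‖h‖ ^ 2 ≤ V (z₂ + h)) ∧
      ∀ h₁ h₂ : E, ⟪A₁ h₁, h₁⟫ - ⟪A₂ h₂, h₂⟫ ≤ α * ‖h₁ - h₂‖ ^ 2 := by
  have hV' : ContinuousOn (fun z => -V z) K := hV.neg
  obtain ⟨R, hR, hdiag, hmax, hbd⟩ := exists_radius_doubled_max hK hne hα hU hV'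
  -- The bound `1` makes the maxima exist, `δ` controls the slopes, and `δ / (2 R)` makes the linear
  -- perturbation at most `δ / 2` in the ball of radius `R`.
  set δ' := min 1 (min δ (δ / (2 * R))) with hδ'
  have hδ'0 : 0 < δ' := by positivity
  have hδ'1 : δ' ≤ 1 := min_le_left _ _
  have hδ'2 : δ' ≤ δ := (min_le_right _ _).trans (min_le_left _ _)
  have hδ'3 : δ' * R ≤ δ / 2 := by
    have : δ' ≤ δ / (2 * R) := (min_le_right _ _).trans (min_le_right _ _)
    calc δ' * R ≤ δ / (2 * R) * R := by gcongr
      _ = _ := by field_simp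
  set W := doubled K α U (fun z => -V z) with hW
  obtain ⟨z, P, A, hP, hzmax, hexp⟩ := exists_second_order_expansion (W := W)
    (lam := 3 * α) (δ := δ') (by positivity) hδ'0
    (doubled_lower_paraboloid hK hne hα hU hV') (fun P hP => hmax P (hP.trans hδ'1))
  -- Translating `z.fst` and `w₁` by the same `h` keeps the convolution penalty fixed, so an
  -- expansion of the sup-convolution at `z.fst` is a one-sided expansion of `U` at `w₁`; likewise
  -- for `w₂`.
  obtain ⟨w₁, hw₁, he₁⟩ := exists_supConv_eq hK hne α hU z.fst
  obtain ⟨w₂, hw₂, he₂⟩ := exists_supConv_eq hK hne α hV' z.snd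
  have hzR := hbd P z (hP.trans hδ'1) hzmax
  set inl : E →L[ℝ] WithLp 2 (E × E) :=
    ((WithLp.prodContinuousLinearEquiv 2 ℝ E E).symm : E × E →L[ℝ] WithLp 2 (E × E)).comp
      (ContinuousLinearMap.inl ℝ E E) with hinl
  set inr : E →L[ℝ] WithLp 2 (E × E) :=
    ((WithLp.prodContinuousLinearEquiv 2 ℝ E E).symm : E × E →L[ℝ] WithLp 2 (E × E)).comp
      (ContinuousLinearMap.inr ℝ E E) with hinr
  have inl_fst : ∀ h, (inl h).fst = h := fun h => rfl
  have inl_snd : ∀ h, (inl h).snd = 0 := fun h => rfl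
  have inr_fst : ∀ h, (inr h).fst = 0 := fun h => rfl
  have inr_snd : ∀ h, (inr h).snd = h := fun h => rfl
  have inl_norm : ∀ h, ‖inl h‖ = ‖h‖ := fun h => WithLp.norm_toLp_fst 2 E E h
  have inr_norm : ∀ h, ‖inr h‖ = ‖h‖ := fun h => WithLp.norm_toLp_snd 2 E E h
  have inner_inl : ∀ (x : WithLp 2 (E × E)) h, ⟪x, inl h⟫ = ⟪x.fst, h⟫ := fun x h => by
    change ⟪x.fst, h⟫ + ⟪x.snd, (0 : E)⟫ = _
    rw [inner_zero_right, add_zero]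
  have inner_inr : ∀ (x : WithLp 2 (E × E)) h, ⟪x, inr h⟫ = ⟪x.snd, h⟫ := fun x h => by
    change ⟪x.fst, (0 : E)⟫ + ⟪x.snd, h⟫ = _
    rw [inner_zero_right, zero_add]
  have exp_l : ∀ ε : ℝ, 0 < ε → ∀ᶠ h in 𝓝 (0 : E),
      |W (z + inl h) - W z - ⟪P.fst, h⟫ - 1 / 2 * ⟪(A (inl h)).fst, h⟫| ≤ ε * ‖h‖ ^ 2 := by
    intro ε hε
    have ht : Tendsto inl (𝓝 0) (𝓝 0) := by simpa using inl.continuous.tendsto 0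
    filter_upwards [ht.eventually (hexp ε hε)] with h hh
    rwa [inner_inl, inner_inl, inl_norm] at hh
  have exp_r : ∀ ε : ℝ, 0 < ε → ∀ᶠ h in 𝓝 (0 : E),
      |W (z + inr h) - W z - ⟪P.snd, h⟫ - 1 / 2 * ⟪(A (inr h)).snd, h⟫| ≤ ε * ‖h‖ ^ 2 := by
    intro ε hε
    have ht : Tendsto inr (𝓝 0) (𝓝 0) := by simpa using inr.continuous.tendsto 0
    filter_upwards [ht.eventually (hexp ε hε)] with h hh
    rwa [inner_inr, inner_inr, inr_norm] at hh
  set e := z.fst - z.snd with he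
  set S₁ := supConv K α U with hS₁
  set S₂ := supConv K α (fun z => -V z) with hS₂
  have W_z : W z = S₁ z.fst + S₂ z.snd - α / 2 * ‖e‖ ^ 2 := rfl
  have W_l : ∀ h, W (z + inl h) = S₁ (z.fst + h) + S₂ z.snd
      - α / 2 * (‖e‖ ^ 2 + 2 * ⟪e, h⟫ + ‖h‖ ^ 2) := by
    intro h
    rw [← norm_add_sq_real]
    simp only [hW, doubled, WithLp.add_fst, WithLp.add_snd, inl_fst, inl_snd, add_zero]
    congr 4; rw [he]; abel
  have W_r : ∀ h, W (z + inr h) = S₁ z.fst + S₂ (z.snd + h)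
      - α / 2 * (‖e‖ ^ 2 - 2 * ⟪e, h⟫ + ‖h‖ ^ 2) := by
    intro h
    rw [← norm_sub_sq_real]
    simp only [hW, doubled, WithLp.add_fst, WithLp.add_snd, inr_fst, inr_snd, add_zero]
    congr 4; rw [he]; abel
  -- The variables interact only through the quadratic penalty, so the mixed second difference is
  -- exact. With maximality at `z` it yields the sharp second order inequality without using the
  -- off-diagonal blocks of `A`.
  have W_lr : ∀ h₁ h₂, W (z + (inl h₁ + inr h₂)) = W (z + inl h₁) + W (z + inr h₂) - W z
      + α * ⟪h₁, h₂⟫ := by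
    intro h₁ h₂
    have : W (z + (inl h₁ + inr h₂)) = S₁ (z.fst + h₁) + S₂ (z.snd + h₂)
        - α / 2 * ‖(e + h₁) - h₂‖ ^ 2 := by
      simp only [hW, doubled, WithLp.add_fst, WithLp.add_snd, inr_fst, inr_snd, inl_fst, inl_snd,
        add_zero, zero_add]
      congr 4; rw [he]; abel
    rw [this, W_l, W_r, W_z, norm_sub_sq_real, norm_add_sq_real, inner_add_left]
    ring
  refine ⟨w₁, hw₁, w₂, hw₂, e, P.fst + α • e, α • e - P.snd,
    (WithLp.fstL 2 ℝ E E).comp (A.comp inl) + α • ContinuousLinearMap.id ℝ E,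
    -((WithLp.sndL 2 ℝ E E).comp (A.comp inr) + α • ContinuousLinearMap.id ℝ E),
    ?_, ?_, ?_, ?_, ?_, ?_⟩
  · rw [add_sub_cancel_right]
    exact (WithLp.norm_fst_le _ _).trans (hP.trans hδ'2)
  · rw [sub_sub_cancel_left, norm_neg]
    exact (WithLp.norm_snd_le _ _).trans (hP.trans hδ'2)
  · intro y hy
    have h1 := hzmax (WithLp.toLp 2 (y, y) - z)
    rw [add_sub_cancel, inner_sub_right] at h1
    have h2 : U y - V y ≤ W (WithLp.toLp 2 (y, y)) := by
      have a := le_supConv hK α hU y hy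
      have b := le_supConv hK α hV' y hy
      simp only [sub_self, norm_zero] at a b
      simp only [hW, doubled, WithLp.toLp_fst, WithLp.toLp_snd, sub_self, norm_zero]
      linarith
    have h3 : ⟪P, WithLp.toLp 2 (y, y)⟫ ≤ δ / 2 := by
      refine (real_inner_le_norm _ _).trans (le_trans ?_ hδ'3)
      gcongr
      exact hdiag y hy
    have h4 : -⟪P, z⟫ ≤ δ / 2 := by
      refine (neg_le_abs _).trans ((abs_real_inner_le_norm _ _).trans (le_trans ?_ hδ'3))
      gcongr
    -- Hence `‖e‖² + ‖w₁ - w₂‖²` is at most four times the sum of the three squares, each of which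
    -- occurs in the maximum with weight `α / 2`; this gives `α / 12` with room to spare.
    have h5 := norm_sub_sq_le_three w₁ w₂ z.fst z.snd
    rw [W_z, he₁, he₂] at h1
    rw [← he] at h5
    nlinarith [sq_nonneg ‖z.fst - w₁‖, sq_nonneg ‖z.snd - w₂‖, sq_nonneg ‖e‖]
  · intro ε hε
    filter_upwards [exp_l ε hε] with h hh hK'
    have a := le_supConv hK α hU (z.fst + h) hK'
    rw [add_sub_add_right_eq_sub, ← hS₁] at a
    have b := (abs_le.1 hh).2
    rw [W_l, W_z] at b
    simp only [add_apply, ContinuousLinearMap.comp_apply,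
      smul_apply, ContinuousLinearMap.id_apply, inner_add_left,
      real_inner_smul_left, real_inner_self_eq_norm_sq]
    change _ ≤ U w₁ + _ + 1 / 2 * (⟪(A (inl h)).fst, h⟫ + _) + _
    linarith
  · intro ε hε
    filter_upwards [exp_r ε hε] with h hh hK'
    have a := le_supConv hK α hV' (z.snd + h) hK'
    rw [add_sub_add_right_eq_sub, ← hS₂] at a
    have b := (abs_le.1 hh).2
    rw [W_r, W_z] at b
    simp only [add_apply, ContinuousLinearMap.comp_apply,
      neg_apply, inner_neg_left, inner_sub_left,
      smul_apply, ContinuousLinearMap.id_apply, inner_add_left,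
      real_inner_smul_left, real_inner_self_eq_norm_sq]
    change V w₂ + _ + 1 / 2 * -(⟪(A (inr h)).snd, h⟫ + _) - _ ≤ _
    linarith
  · intro h₁ h₂
    simp only [add_apply, ContinuousLinearMap.comp_apply,
      neg_apply, inner_neg_left,
      smul_apply, ContinuousLinearMap.id_apply, inner_add_left,
      real_inner_smul_left, real_inner_self_eq_norm_sq, norm_sub_sq_real]
    change ⟪(A (inl h₁)).fst, h₁⟫ + _ - -(⟪(A (inr h₂)).snd, h₂⟫ + _) ≤ _
    set a₁ := ⟪(A (inl h₁)).fst, h₁⟫ with ha₁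
    set a₂ := ⟪(A (inr h₂)).snd, h₂⟫ with ha₂
    suffices H : ∀ ε : ℝ, 0 < ε → a₁ + a₂ + 2 * (α * ⟪h₁, h₂⟫) ≤
        ε * (2 * (‖h₁‖ ^ 2 + ‖h₂‖ ^ 2)) by
      have : a₁ + a₂ + 2 * (α * ⟪h₁, h₂⟫) ≤ 0 := by
        refine le_of_forall_pos_le_add fun η hη => ?_
        have hpos : 0 < 2 * (‖h₁‖ ^ 2 + ‖h₂‖ ^ 2) + 1 := by positivity
        have := H (η / (2 * (‖h₁‖ ^ 2 + ‖h₂‖ ^ 2) + 1)) (by positivity)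
        refine this.trans ?_
        rw [zero_add, div_mul_eq_mul_div, div_le_iff₀ hpos]
        nlinarith
      linarith
    intro ε hε
    have hsm : ∀ h : E, Tendsto (fun t : ℝ => t • h) (𝓝[>] 0) (𝓝 0) := by
      intro h
      have : Continuous fun t : ℝ => t • h := by fun_prop
      simpa using (this.tendsto 0).mono_left nhdsWithin_le_nhds
    obtain ⟨t, ⟨hl, hr⟩, ht⟩ := (((hsm h₁).eventually (exp_l ε hε)).and
      ((hsm h₂).eventually (exp_r ε hε))).and self_mem_nhdsWithin |>.exists
    have ht : 0 < t := ht
    have hm := hzmax (inl (t • h₁) + inr (t • h₂))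
    rw [W_lr, inner_add_right, inner_inl, inner_inr] at hm
    have hl := (abs_le.1 hl).1
    have hr := (abs_le.1 hr).1
    have e1 : ⟪(A (inl (t • h₁))).fst, t • h₁⟫ = t ^ 2 * a₁ := by
      rw [map_smul, map_smul, WithLp.smul_fst, inner_smul_right, real_inner_smul_left]; ring
    have e2 : ⟪(A (inr (t • h₂))).snd, t • h₂⟫ = t ^ 2 * a₂ := by
      rw [map_smul, map_smul, WithLp.smul_snd, inner_smul_right, real_inner_smul_left]; ring
    rw [e1] at hl
    rw [e2] at hr
    have e3 : ⟪t • h₁, t • h₂⟫ = t ^ 2 * ⟪h₁, h₂⟫ := by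
      rw [inner_smul_right, real_inner_smul_left]; ring
    have e4 : ∀ h : E, ‖t • h‖ ^ 2 = t ^ 2 * ‖h‖ ^ 2 := by
      intro h; rw [norm_smul, mul_pow, Real.norm_eq_abs, sq_abs]
    rw [e3] at hm
    rw [e4] at hl hr
    have : t ^ 2 * (a₁ + a₂ + 2 * (α * ⟪h₁, h₂⟫)) ≤ t ^ 2 * (ε * (2 * (‖h₁‖ ^ 2 + ‖h₂‖ ^ 2))) := by
      linarith
    exact le_of_mul_le_mul_left this (by positivity)

end Sums

/-! ### The structure condition for the nonlinearity and its time average. -/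

section Coefficients

variable {n d : ℕ}

/-- The vector `M w`. -/
noncomputable def colMul {m k : ℕ} (M : Matrix (Fin m) (Fin k) ℝ) (w : Vec k) : Vec m :=
  WithLp.toLp 2 (M *ᵥ w.ofLp)

lemma norm_colMul_le {m k : ℕ} (M : Matrix (Fin m) (Fin k) ℝ) (w : Vec k) :
    ‖colMul M w‖ ≤ frob M * ‖w‖ := by
  have hfrob0 : 0 ≤ frob M := Real.sqrt_nonneg _
  refine abs_le_of_sq_le_sq' ?_ (mul_nonneg hfrob0 (norm_nonneg _)) |>.2
  have hfrob : frob M ^ 2 = ∑ i, ∑ j, M i j ^ 2 := Real.sq_sqrt (by positivity)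
  rw [mul_pow, hfrob, EuclideanSpace.real_norm_sq_eq,
    EuclideanSpace.real_norm_sq_eq, Finset.sum_mul]
  refine Finset.sum_le_sum fun i _ => ?_
  have := Finset.sum_mul_sq_le_sq_mul_sq Finset.univ (M i) w.ofLp
  exact this

lemma rowMul_eq_colMul {m k : ℕ} (p : Vec m) (M : Matrix (Fin m) (Fin k) ℝ) :
    rowMul p M = colMul Mᵀ p := by
  rw [rowMul, colMul, Matrix.mulVec_transpose]

lemma frob_transpose {m k : ℕ} (M : Matrix (Fin m) (Fin k) ℝ) : frob Mᵀ = frob M := by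
  simp only [frob, Matrix.transpose_apply]
  rw [Finset.sum_comm]

lemma norm_rowMul_le {m k : ℕ} (p : Vec m) (M : Matrix (Fin m) (Fin k) ℝ) :
    ‖rowMul p M‖ ≤ frob M * ‖p‖ := by
  rw [rowMul_eq_colMul, ← frob_transpose]; exact norm_colMul_le _ _

lemma rowMul_sub {m k : ℕ} (p : Vec m) (M N : Matrix (Fin m) (Fin k) ℝ) :
    rowMul p (M - N) = rowMul p M - rowMul p N := by
  simp [rowMul, Matrix.vecMul_sub]

lemma sub_rowMul {m k : ℕ} (p q : Vec m) (M : Matrix (Fin m) (Fin k) ℝ) :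
    rowMul (p - q) M = rowMul p M - rowMul q M := by
  simp [rowMul, Matrix.sub_vecMul]

lemma sub_colMul {m k : ℕ} (M N : Matrix (Fin m) (Fin k) ℝ) (w : Vec k) :
    colMul (M - N) w = colMul M w - colMul N w := by
  simp [colMul, Matrix.sub_mulVec]

lemma quadForm_eq_sum (X : Matrix (Fin n) (Fin n) ℝ) (w : Vec n) :
    quadForm X w = ∑ i, (∑ j, X i j * w j) * w i := rfl

lemma quadForm_add (X Y : Matrix (Fin n) (Fin n) ℝ) (w : Vec n) :
    quadForm (X + Y) w = quadForm X w + quadForm Y w := by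
  simp [quadForm, Matrix.add_mulVec, add_dotProduct]

lemma quadForm_sub (X Y : Matrix (Fin n) (Fin n) ℝ) (w : Vec n) :
    quadForm (X - Y) w = quadForm X w - quadForm Y w := by
  simp [quadForm, Matrix.sub_mulVec, sub_dotProduct]

lemma quadForm_smul_one (κ : ℝ) (w : Vec n) :
    quadForm (κ • (1 : Matrix (Fin n) (Fin n) ℝ)) w = κ * ‖w‖ ^ 2 := by
  rw [EuclideanSpace.real_norm_sq_eq, Finset.mul_sum]
  simp only [quadForm, Matrix.smul_mulVec, Matrix.one_mulVec, dotProduct, Pi.smul_apply,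
    smul_eq_mul]
  exact Finset.sum_congr rfl fun i _ => by ring

lemma quadForm_conj (s : Matrix (Fin n) (Fin d) ℝ) (X : Matrix (Fin n) (Fin n) ℝ) (w : Vec d) :
    quadForm (sᵀ * X * s) w = quadForm X (colMul s w) := by
  simp only [quadForm, colMul]
  rw [← Matrix.mulVec_mulVec, ← Matrix.mulVec_mulVec, Matrix.mulVec_transpose,
    ← Matrix.dotProduct_mulVec]

lemma abs_quadForm_le (X : Matrix (Fin n) (Fin n) ℝ) (w : Vec n) :
    |quadForm X w| ≤ (∑ i, ∑ j, |X i j|) * ‖w‖ ^ 2 := by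
  have hc : ∀ i, |w i| ≤ ‖w‖ := fun i => PiLp.norm_apply_le w i
  rw [quadForm_eq_sum, Finset.sum_mul]
  refine (Finset.abs_sum_le_sum_abs _ _).trans (Finset.sum_le_sum fun i _ => ?_)
  rw [abs_mul]
  have h1 : |∑ j, X i j * w j| ≤ (∑ j, |X i j|) * ‖w‖ := by
    rw [Finset.sum_mul]
    refine (Finset.abs_sum_le_sum_abs _ _).trans (Finset.sum_le_sum fun j _ => ?_)
    rw [abs_mul]
    exact mul_le_mul_of_nonneg_left (hc j) (abs_nonneg _)
  calc |∑ j, X i j * w j| * |w i| ≤ (∑ j, |X i j|) * ‖w‖ * ‖w‖ :=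
        mul_le_mul h1 (hc i) (abs_nonneg _) (by positivity)
    _ = _ := by ring

variable {G : Matrix (Fin d) (Fin d) ℝ → ℝ}

lemma posSemidef_sub_of_quadForm_le {A B : Matrix (Fin d) (Fin d) ℝ} (hA : A.IsSymm)
    (hB : B.IsSymm) (h : ∀ w, quadForm B w ≤ quadForm A w) : (A - B).PosSemidef := by
  refine Matrix.PosSemidef.of_dotProduct_mulVec_nonneg ?_ fun w => ?_
  · rw [Matrix.IsHermitian, Matrix.conjTranspose_eq_transpose_of_trivial]
    exact hA.sub hB
  · have := h (WithLp.toLp 2 w)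
    rw [← sub_nonneg, ← quadForm_sub, quadForm, dotProduct_comm] at this
    simpa using this

/-- Compare `A` with `κ • 1` by monotonicity and use homogeneity. -/
lemma IsGFunction.le_of_quadForm_le (hG : IsGFunction G) {A : Matrix (Fin d) (Fin d) ℝ}
    (hA : A.IsSymm) {κ : ℝ} (hκ : 0 ≤ κ) (h : ∀ w, quadForm A w ≤ κ * ‖w‖ ^ 2) :
    G A ≤ G 1 * κ := by
  have hone : (1 : Matrix (Fin d) (Fin d) ℝ).IsSymm := Matrix.isSymm_one
  have h1 := hG.mono (κ • 1) A (hone.smul κ) hA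
    (posSemidef_sub_of_quadForm_le (hone.smul κ) hA fun w => by rw [quadForm_smul_one]; exact h w)
  rw [hG.pos_homog κ 1 hκ hone] at h1
  linarith

lemma IsGFunction.map_zero (hG : IsGFunction G) : G 0 = 0 := by
  simpa using hG.pos_homog 0 0 le_rfl Matrix.isSymm_zero

lemma IsGFunction.one_nonneg (hG : IsGFunction G) : 0 ≤ G 1 := by
  rw [← hG.map_zero]
  refine hG.mono 1 0 Matrix.isSymm_one Matrix.isSymm_zero
    (posSemidef_sub_of_quadForm_le Matrix.isSymm_one Matrix.isSymm_zero fun w => ?_)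
  have := quadForm_smul_one 1 w
  rw [one_smul] at this
  rw [this]
  simp only [quadForm, Matrix.zero_mulVec, zero_dotProduct]
  positivity

lemma IsGFunction.sub_le (hG : IsGFunction G) {A B : Matrix (Fin d) (Fin d) ℝ} (hA : A.IsSymm)
    (hB : B.IsSymm) : G A - G B ≤ G (A - B) := by
  have := hG.subadd (A - B) B (hA.sub hB) hB
  rw [sub_add_cancel] at this
  linarith

/-- Lipschitz continuity in the entries, from which the time continuity of `G ∘ H` is deduced. -/
lemma IsGFunction.abs_sub_le (hG : IsGFunction G) {A B : Matrix (Fin d) (Fin d) ℝ}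
    (hA : A.IsSymm) (hB : B.IsSymm) : |G A - G B| ≤ G 1 * ∑ i, ∑ j, |A i j - B i j| := by
  have key : ∀ A B : Matrix (Fin d) (Fin d) ℝ, A.IsSymm → B.IsSymm →
      G A - G B ≤ G 1 * ∑ i, ∑ j, |A i j - B i j| := fun A B hA hB =>
    (hG.sub_le hA hB).trans (hG.le_of_quadForm_le (hA.sub hB) (by positivity)
      fun w => (le_abs_self _).trans (abs_quadForm_le _ _))
  refine abs_le.2 ⟨?_, key A B hA hB⟩
  have := key B A hB hA
  simp only [abs_sub_comm (B _ _)] at this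
  linarith

lemma Coefficients.H_isSymm {c : Coefficients n d} (hh : ∀ i j, c.h i j = c.h j i)
    (hg : ∀ i j, c.g i j = c.g j i) (r : ℝ) (x : Vec n) (v : ℝ) (p : Vec n)
    {A : Matrix (Fin n) (Fin n) ℝ} (hA : A.IsSymm) : (c.H r x v p A).IsSymm := by
  have hs : ((c.sigma r x)ᵀ * A * c.sigma r x).IsSymm := by
    rw [Matrix.IsSymm, Matrix.transpose_mul, Matrix.transpose_mul, Matrix.transpose_transpose,
      hA.eq, Matrix.mul_assoc]
  refine Matrix.IsSymm.ext fun i j => ?_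
  simp only [Coefficients.H, Matrix.of_apply]
  rw [hh j i, hg j i, hs.apply]

/-- The quantity controlling the increments of the nonlinearity. -/
noncomputable def modulus (m : ℕ) (α κ : ℝ) (x₁ x₂ : Vec n) (y₁ y₂ : ℝ) (q₁ q₂ : Vec n) : ℝ :=
  α * ‖x₁ - x₂‖ ^ 2 + κ * (1 + ‖x₁‖) ^ 2 + (‖q₁ - q₂‖ * (1 + ‖x₁‖) + ‖q₂‖ * ‖x₁ - x₂‖)
    + (1 + ‖x₁‖ ^ m + ‖x₂‖ ^ m) * ‖x₁ - x₂‖ + |y₁ - y₂|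

/-- The structure condition for the nonlinearity, uniformly in time. -/
theorem Coefficients.F_sub_le {c : Coefficients n d} (hG : IsGFunction c.G)
    (hh : ∀ i j, c.h i j = c.h j i) (hg : ∀ i j, c.g i j = c.g j i)
    (hforward : c.LipschitzForward) (hbackward : c.LipschitzBackward) :
    ∃ (C : ℝ) (m : ℕ), 0 < C ∧ ∀ r : ℝ, 0 ≤ r → ∀ (x₁ x₂ : Vec n) (y₁ y₂ : ℝ) (q₁ q₂ : Vec n)
      (X₁ X₂ : Matrix (Fin n) (Fin n) ℝ) (α κ : ℝ), X₁.IsSymm → X₂.IsSymm → 0 ≤ α → 0 ≤ κ →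
      (∀ w₁ w₂, quadForm X₁ w₁ - quadForm X₂ w₂ ≤ α * ‖w₁ - w₂‖ ^ 2 + κ * ‖w₁‖ ^ 2) →
      c.F r x₁ y₁ q₁ X₁ - c.F r x₂ y₂ q₂ X₂ ≤ C * modulus m α κ x₁ x₂ y₁ y₂ q₁ q₂ := by
  obtain ⟨L, hL, hfw⟩ := hforward
  obtain ⟨L', m, hL', -, hbw, -⟩ := hbackward
  have hG1 := hG.one_nonneg
  -- Deliberately generous: the difference of the two sides is then visibly a sum of nonnegative
  -- terms.
  refine ⟨c.G 1 * L ^ 2 + (2 * c.G 1 * (d : ℝ) ^ 2 + 1) * (L + L' + L' * L), m, by positivity, ?_⟩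
  intro r hr x₁ x₂ y₁ y₂ q₁ q₂ X₁ X₂ α κ hX₁ hX₂ hα hκ hX
  obtain ⟨hlip, hb0, hh0, hs0⟩ := hfw r hr
  obtain ⟨hbl, -⟩ := hbw r hr
  set s := ‖q₁ - q₂‖ * (1 + ‖x₁‖) + ‖q₂‖ * ‖x₁ - x₂‖ with hs
  set D := (1 + ‖x₁‖ ^ m + ‖x₂‖ ^ m) * ‖x₁ - x₂‖ with hD
  have hs0' : 0 ≤ s := by positivity
  have hD0 : 0 ≤ D := by positivity
  have hvec : ∀ β : Vec n → Vec n, (∀ x x', ‖β x - β x'‖ ≤ L * ‖x - x'‖) → ‖β 0‖ ≤ L →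
      |inner ℝ q₁ (β x₁) - inner ℝ q₂ (β x₂)| ≤ L * s := by
    intro β h1 h2
    have e : inner ℝ q₁ (β x₁) - inner ℝ q₂ (β x₂)
        = inner ℝ (q₁ - q₂) (β x₁) + inner ℝ q₂ (β x₁ - β x₂) := by
      rw [inner_sub_left, inner_sub_right]; ring
    have h3 : ‖β x₁‖ ≤ L * (1 + ‖x₁‖) := by
      have h4 := h1 x₁ 0
      rw [sub_zero] at h4
      have h5 := norm_le_norm_add_norm_sub (β 0) (β x₁)
      rw [norm_sub_rev] at h5
      linarith
    rw [e]
    refine (abs_add_le _ _).trans ?_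
    calc |inner ℝ (q₁ - q₂) (β x₁)| + |inner ℝ q₂ (β x₁ - β x₂)|
        ≤ ‖q₁ - q₂‖ * ‖β x₁‖ + ‖q₂‖ * ‖β x₁ - β x₂‖ :=
          add_le_add (abs_real_inner_le_norm _ _) (abs_real_inner_le_norm _ _)
      _ ≤ ‖q₁ - q₂‖ * (L * (1 + ‖x₁‖)) + ‖q₂‖ * (L * ‖x₁ - x₂‖) := by
          gcongr; exact h1 _ _
      _ = L * s := by rw [hs]; ring
  have hb := hvec (c.b r) (fun x x' => (hlip x x').1) hb0
  have hhh := fun i j => hvec (c.h i j r) (fun x x' => (hlip x x').2.1 i j) (hh0 i j)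
  have hrow : ‖rowMul q₁ (c.sigma r x₁) - rowMul q₂ (c.sigma r x₂)‖ ≤ L * s := by
    have e : rowMul q₁ (c.sigma r x₁) - rowMul q₂ (c.sigma r x₂)
        = (rowMul (q₁ - q₂) (c.sigma r x₁ - c.sigma r 0) + rowMul (q₁ - q₂) (c.sigma r 0))
          + rowMul q₂ (c.sigma r x₁ - c.sigma r x₂) := by
      simp only [rowMul_sub, sub_rowMul]; abel
    have h1 : frob (c.sigma r x₁ - c.sigma r 0) ≤ L * ‖x₁‖ := by
      simpa using (hlip x₁ 0).2.2
    rw [e]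
    refine (norm_add₃_le).trans ?_
    calc _ ≤ L * ‖x₁‖ * ‖q₁ - q₂‖ + L * ‖q₁ - q₂‖ + L * ‖x₁ - x₂‖ * ‖q₂‖ := by
          refine add_le_add (add_le_add ?_ ?_) ?_
          · exact (norm_rowMul_le _ _).trans (by gcongr)
          · exact (norm_rowMul_le _ _).trans (by gcongr)
          · exact (norm_rowMul_le _ _).trans (by gcongr; exact (hlip x₁ x₂).2.2)
      _ = L * s := by rw [hs]; ring
  set Γ := L' * (D + |y₁ - y₂| + L * s) with hΓ
  have hf : c.f r x₁ y₁ (rowMul q₁ (c.sigma r x₁)) - c.f r x₂ y₂ (rowMul q₂ (c.sigma r x₂)) ≤ Γ :=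
    (le_abs_self _).trans (((hbl _ _ _ _ _ _).1).trans (by rw [hΓ]; gcongr))
  have hgg : ∀ i j, |c.g i j r x₁ y₁ (rowMul q₁ (c.sigma r x₁))
      - c.g i j r x₂ y₂ (rowMul q₂ (c.sigma r x₂))| ≤ Γ := fun i j =>
    ((hbl _ _ _ _ _ _).2 i j).trans (by rw [hΓ]; gcongr)
  have hΓ0 : 0 ≤ Γ := by positivity
  have hcol : ∀ w : Vec d, ‖colMul (c.sigma r x₁) w - colMul (c.sigma r x₂) w‖
      ≤ L * ‖x₁ - x₂‖ * ‖w‖ := fun w => by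
    rw [← sub_colMul]
    refine (norm_colMul_le _ _).trans ?_
    gcongr; exact (hlip x₁ x₂).2.2
  have hcol1 : ∀ w : Vec d, ‖colMul (c.sigma r x₁) w‖ ≤ L * (1 + ‖x₁‖) * ‖w‖ := fun w => by
    have e : colMul (c.sigma r x₁) w
        = colMul (c.sigma r x₁ - c.sigma r 0) w + colMul (c.sigma r 0) w := by
      rw [sub_colMul]; abel
    have h1 : frob (c.sigma r x₁ - c.sigma r 0) ≤ L * ‖x₁‖ := by
      simpa using (hlip x₁ 0).2.2
    rw [e]
    refine (norm_add_le _ _).trans ?_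
    calc _ ≤ L * ‖x₁‖ * ‖w‖ + L * ‖w‖ := by
          refine add_le_add ?_ ?_
          · exact (norm_colMul_le _ _).trans (by gcongr)
          · exact (norm_colMul_le _ _).trans (by gcongr)
      _ = _ := by ring
  set M : Matrix (Fin d) (Fin d) ℝ := Matrix.of fun i j =>
    2 * (inner ℝ q₁ (c.h i j r x₁) - inner ℝ q₂ (c.h i j r x₂))
      + 2 * (c.g i j r x₁ y₁ (rowMul q₁ (c.sigma r x₁))
        - c.g i j r x₂ y₂ (rowMul q₂ (c.sigma r x₂))) with hM
  have hMsum : ∑ i, ∑ j, |M i j| ≤ (d : ℝ) ^ 2 * (2 * (L * s) + 2 * Γ) := by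
    have : ∀ i j, |M i j| ≤ 2 * (L * s) + 2 * Γ := fun i j => by
      simp only [hM, Matrix.of_apply]
      refine (abs_add_le _ _).trans ?_
      rw [abs_mul, abs_mul, abs_two]
      linarith [hhh i j, hgg i j]
    calc ∑ i, ∑ j, |M i j| ≤ ∑ _i : Fin d, ∑ _j : Fin d, (2 * (L * s) + 2 * Γ) :=
          Finset.sum_le_sum fun i _ => Finset.sum_le_sum fun j _ => this i j
      _ = _ := by simp; ring
  have hHdiff : c.H r x₁ y₁ q₁ X₁ - c.H r x₂ y₂ q₂ X₂
      = ((c.sigma r x₁)ᵀ * X₁ * c.sigma r x₁ - (c.sigma r x₂)ᵀ * X₂ * c.sigma r x₂) + M := by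
    ext i j
    simp only [Coefficients.H, hM, Matrix.sub_apply, Matrix.add_apply, Matrix.of_apply]
    ring
  have hquad : ∀ w, quadForm (c.H r x₁ y₁ q₁ X₁ - c.H r x₂ y₂ q₂ X₂) w ≤
      (α * (L * ‖x₁ - x₂‖) ^ 2 + κ * (L * (1 + ‖x₁‖)) ^ 2
        + (d : ℝ) ^ 2 * (2 * (L * s) + 2 * Γ)) * ‖w‖ ^ 2 := by
    intro w
    rw [hHdiff, quadForm_add, quadForm_sub, quadForm_conj, quadForm_conj]
    -- The matrix inequality tested with `σ(x₁) w` and `σ(x₂) w`: Lipschitz continuity of `σ` turns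
    -- the factor `α` into `α L² ‖x₁ - x₂‖²`, and its linear growth handles the `κ` term.
    have h1 := hX (colMul (c.sigma r x₁) w) (colMul (c.sigma r x₂) w)
    have h2 : α * ‖colMul (c.sigma r x₁) w - colMul (c.sigma r x₂) w‖ ^ 2
        ≤ α * (L * ‖x₁ - x₂‖ * ‖w‖) ^ 2 := by gcongr; exact hcol w
    have h3 : κ * ‖colMul (c.sigma r x₁) w‖ ^ 2 ≤ κ * (L * (1 + ‖x₁‖) * ‖w‖) ^ 2 := by
      gcongr; exact hcol1 w
    have h4 : quadForm M w ≤ (d : ℝ) ^ 2 * (2 * (L * s) + 2 * Γ) * ‖w‖ ^ 2 :=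
      (le_abs_self _).trans ((abs_quadForm_le M w).trans (by gcongr))
    rw [mul_pow _ ‖w‖] at h2 h3
    linarith
  have hH₁ := c.H_isSymm hh hg r x₁ y₁ q₁ hX₁
  have hH₂ := c.H_isSymm hh hg r x₂ y₂ q₂ hX₂
  have hGle := (hG.sub_le hH₁ hH₂).trans
    (hG.le_of_quadForm_le (hH₁.sub hH₂) (by positivity) hquad)
  have hb' := (le_abs_self _).trans hb
  have htotal : c.F r x₁ y₁ q₁ X₁ - c.F r x₂ y₂ q₂ X₂ ≤
      c.G 1 * (α * (L * ‖x₁ - x₂‖) ^ 2 + κ * (L * (1 + ‖x₁‖)) ^ 2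
        + (d : ℝ) ^ 2 * (2 * (L * s) + 2 * Γ)) + L * s + Γ := by
    simp only [Coefficients.F]; linarith
  refine htotal.trans ?_
  rw [← sub_nonneg]
  set T₁ := α * ‖x₁ - x₂‖ ^ 2 + κ * (1 + ‖x₁‖) ^ 2 with hT₁
  have hT₁0 : 0 ≤ T₁ := by positivity
  have e : (c.G 1 * L ^ 2 + (2 * c.G 1 * (d : ℝ) ^ 2 + 1) * (L + L' + L' * L)) *
      modulus m α κ x₁ x₂ y₁ y₂ q₁ q₂ -
      (c.G 1 * (α * (L * ‖x₁ - x₂‖) ^ 2 + κ * (L * (1 + ‖x₁‖)) ^ 2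
        + (d : ℝ) ^ 2 * (2 * (L * s) + 2 * Γ)) + L * s + Γ)
      = c.G 1 * L ^ 2 * (s + D + |y₁ - y₂|) + (2 * c.G 1 * (d : ℝ) ^ 2 + 1) *
        ((L + L' + L' * L) * T₁ + L' * s + (L + L' * L) * (D + |y₁ - y₂|)) := by
    simp only [modulus, ← hs, ← hD, hΓ, hT₁]; ring
  rw [e]
  positivity

variable {c : Coefficients n d}

/-- Needed for integrability in time, so that the integrals in the averages are genuine rather than
the default value `0`. -/
lemma Coefficients.continuousOn_F {T : ℝ} (hc : c.Standing T) (x : Vec n) (y : ℝ) (q : Vec n)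
    {X : Matrix (Fin n) (Fin n) ℝ} (hX : X.IsSymm) :
    ContinuousOn (fun r => c.F r x y q X) (Set.Ici 0) := by
  have hx : ContinuousOn (fun r : ℝ => (r, x)) (Set.Ici 0) := by fun_prop
  have hmx : Set.MapsTo (fun r : ℝ => (r, x)) (Set.Ici 0) (nonnegTimes (Vec n)) := fun r hr => hr
  have hb : ContinuousOn (fun r => c.b r x) (Set.Ici 0) := hc.cont_b.comp hx hmx
  have hs : ContinuousOn (fun r => c.sigma r x) (Set.Ici 0) := hc.cont_sigma.comp hx hmx
  have hrow : ContinuousOn (fun r => rowMul q (c.sigma r x)) (Set.Ici 0) := by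
    have h1 : ContinuousOn (fun r => Matrix.vecMul q.ofLp (c.sigma r x)) (Set.Ici 0) := by
      have : Continuous fun M : Matrix (Fin n) (Fin d) ℝ => Matrix.vecMul q.ofLp M :=
        continuous_const.matrix_vecMul continuous_id
      exact this.comp_continuousOn hs
    exact (PiLp.continuous_toLp 2 _).comp_continuousOn h1
  have hp : ContinuousOn (fun r : ℝ => (r, x, y, rowMul q (c.sigma r x))) (Set.Ici 0) := by
    fun_prop
  have hf : ContinuousOn (fun r => c.f r x y (rowMul q (c.sigma r x))) (Set.Ici 0) :=
    hc.cont_f.comp hp fun r hr => hr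
  have hg : ∀ i j, ContinuousOn (fun r => c.g i j r x y (rowMul q (c.sigma r x))) (Set.Ici 0) :=
    fun i j => (hc.cont_g i j).comp hp fun r hr => hr
  have hh : ∀ i j, ContinuousOn (fun r => c.h i j r x) (Set.Ici 0) :=
    fun i j => (hc.cont_h i j).comp hx hmx
  have hentry : ∀ i j, ContinuousOn (fun r => c.H r x y q X i j) (Set.Ici 0) := by
    intro i j
    simp only [Coefficients.H, Matrix.of_apply]
    have h1 : ContinuousOn (fun r => ((c.sigma r x)ᵀ * X * c.sigma r x) i j) (Set.Ici 0) := by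
      have : Continuous fun M : Matrix (Fin n) (Fin d) ℝ => (Mᵀ * X * M) i j :=
        Continuous.matrix_elem (by fun_prop) i j
      exact this.comp_continuousOn hs
    exact (h1.add (continuousOn_const.mul (continuousOn_const.inner (hh i j)))).add
      (continuousOn_const.mul (hg i j))
  have hGH : ContinuousOn (fun r => c.G (c.H r x y q X)) (Set.Ici 0) := by
    intro r₀ hr₀
    rw [ContinuousWithinAt, tendsto_iff_norm_sub_tendsto_zero]
    have hlim : Tendsto (fun r => c.G 1 * ∑ i, ∑ j, |c.H r x y q X i j - c.H r₀ x y q X i j|)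
        (𝓝[Set.Ici 0] r₀) (𝓝 0) := by
      have : ContinuousOn
          (fun r => c.G 1 * ∑ i, ∑ j, |c.H r x y q X i j - c.H r₀ x y q X i j|)
          (Set.Ici 0) := by
        refine continuousOn_const.mul (continuousOn_finsetSum _ fun i _ =>
          continuousOn_finsetSum _ fun j _ => ?_)
        exact ((hentry i j).sub continuousOn_const).abs
      simpa using (this r₀ hr₀).tendsto
    refine squeeze_zero (fun _ => norm_nonneg _) (fun r => ?_) hlim
    exact hc.isG.abs_sub_le (c.H_isSymm hc.h_symm hc.g_symm r x y q hX)
      (c.H_isSymm hc.h_symm hc.g_symm r₀ x y q hX)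
  exact (hGH.add (continuousOn_const.inner hb)).add hf

/-- Bounds on the increments of the nonlinearity pass to its time average. -/
lemma Coefficients.Fbar_sub_le {T : ℝ} (hc : c.Standing T) (havg : c.HasAverage)
    {x₁ x₂ : Vec n} {y₁ y₂ : ℝ} {q₁ q₂ : Vec n} {X₁ X₂ : Matrix (Fin n) (Fin n) ℝ}
    (hX₁ : X₁.IsSymm) (hX₂ : X₂.IsSymm) {B : ℝ}
    (hB : ∀ r, 0 ≤ r → c.F r x₁ y₁ q₁ X₁ - c.F r x₂ y₂ q₂ X₂ ≤ B) :
    c.Fbar x₁ y₁ q₁ X₁ - c.Fbar x₂ y₂ q₂ X₂ ≤ B := by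
  have h1 := tendsto_nhds_limUnder (havg x₁ y₁ q₁ X₁ hX₁)
  have h2 := tendsto_nhds_limUnder (havg x₂ y₂ q₂ X₂ hX₂)
  refine le_of_tendsto (h1.sub h2) ?_
  filter_upwards [eventually_gt_atTop 0] with s hs
  have i1 : IntervalIntegrable (fun r => c.F r x₁ y₁ q₁ X₁) MeasureTheory.volume 0 s :=
    ((c.continuousOn_F hc x₁ y₁ q₁ hX₁).mono (by
      rw [Set.uIcc_of_le hs.le]; exact Set.Icc_subset_Ici_self)).intervalIntegrable
  have i2 : IntervalIntegrable (fun r => c.F r x₂ y₂ q₂ X₂) MeasureTheory.volume 0 s :=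
    ((c.continuousOn_F hc x₂ y₂ q₂ hX₂).mono (by
      rw [Set.uIcc_of_le hs.le]; exact Set.Icc_subset_Ici_self)).intervalIntegrable
  have h3 := intervalIntegral.integral_mono_on hs.le (i1.sub i2)
    (intervalIntegrable_const (c := B)) fun r hr => hB r hr.1
  rw [intervalIntegral.integral_sub i1 i2, intervalIntegral.integral_const, sub_zero,
    smul_eq_mul] at h3
  simp only [Coefficients.timeAverage]
  rw [← mul_sub, one_div_mul_eq_div, div_le_iff₀ hs]
  linarith

end Coefficients

/-! ### From expansions in time-space to parabolic jets. -/

section Jets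

variable {n : ℕ}

lemma superjet_add {u w : ℝ → Vec n → ℝ} {t : ℝ} {x : Vec n} {p p' : ℝ} {q q' : Vec n}
    {X X' : Matrix (Fin n) (Fin n) ℝ} (hu : (p, q, X) ∈ superjet u t x)
    (hw : (p', q', X') ∈ superjet w t x) :
    (p + p', q + q', X + X') ∈ superjet (fun s y => u s y + w s y) t x := by
  refine ⟨hu.1.add hw.1, fun ε hε => ?_⟩
  filter_upwards [hu.2 (ε / 2) (by positivity), hw.2 (ε / 2) (by positivity)] with z h1 h2
  simp only [quadForm_add, inner_add_left] at h1 h2 ⊢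
  linarith

lemma superjet_const_mul {u : ℝ → Vec n → ℝ} {t : ℝ} {x : Vec n} {p : ℝ} {q : Vec n} {κ a : ℝ}
    (ha : 0 < a) (hu : (p, q, κ • (1 : Matrix (Fin n) (Fin n) ℝ)) ∈ superjet u t x) :
    (a * p, a • q, (a * κ) • (1 : Matrix (Fin n) (Fin n) ℝ)) ∈
      superjet (fun s y => a * u s y) t x := by
  refine ⟨Matrix.isSymm_one.smul _, fun ε hε => ?_⟩
  filter_upwards [hu.2 (ε / a) (by positivity)] with z h1
  simp only [quadForm_smul_one, real_inner_smul_left] at h1 ⊢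
  have h2 := mul_le_mul_of_nonneg_left h1 ha.le
  refine h2.trans (le_of_eq ?_)
  field_simp

/-- Time-space as a Euclidean space. -/
abbrev TimeSpace (n : ℕ) : Type := WithLp 2 (ℝ × Vec n)

/-- The inclusion of the space directions. -/
noncomputable def spaceIncl (w : Vec n) : TimeSpace n := WithLp.toLp 2 (0, w)

/-- The symmetric matrix of the restriction to the space directions of the quadratic form of an
operator. -/
noncomputable def spaceMatrix (A : TimeSpace n →L[ℝ] TimeSpace n) : Matrix (Fin n) (Fin n) ℝ :=
  Matrix.of fun i j =>
    1 / 2 * (inner ℝ (A (spaceIncl (EuclideanSpace.single i 1))) (spaceIncl (EuclideanSpace.single j 1))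
      + inner ℝ (A (spaceIncl (EuclideanSpace.single j 1))) (spaceIncl (EuclideanSpace.single i 1)))

lemma spaceMatrix_isSymm (A : TimeSpace n →L[ℝ] TimeSpace n) : (spaceMatrix A).IsSymm :=
  Matrix.IsSymm.ext fun i j => by simp only [spaceMatrix, Matrix.of_apply]; ring

lemma spaceMatrix_neg (A : TimeSpace n →L[ℝ] TimeSpace n) : spaceMatrix (-A) = -spaceMatrix A := by
  ext i j
  simp only [spaceMatrix, Matrix.of_apply, neg_apply, inner_neg_left, Matrix.neg_apply]
  ring

lemma norm_spaceIncl (w : Vec n) : ‖spaceIncl w‖ = ‖w‖ := WithLp.norm_toLp_snd 2 ℝ (Vec n) w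

lemma spaceIncl_eq_sum (w : Vec n) :
    spaceIncl w = ∑ i, w i • (spaceIncl (EuclideanSpace.single i 1) : TimeSpace n) := by
  let f : Vec n →ₗ[ℝ] TimeSpace n :=
    (WithLp.linearEquiv 2 ℝ (ℝ × Vec n)).symm.toLinearMap ∘ₗ LinearMap.inr ℝ ℝ (Vec n)
  have hf : ∀ w, f w = spaceIncl w := fun w => rfl
  have hw : w = ∑ i, w i • (EuclideanSpace.single i (1 : ℝ) : Vec n) := by
    simpa using ((EuclideanSpace.basisFun (Fin n) ℝ).sum_repr w).symm
  simp only [← hf]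
  conv_lhs => rw [hw]
  simp only [map_sum, map_smul]

lemma quadForm_spaceMatrix (A : TimeSpace n →L[ℝ] TimeSpace n) (w : Vec n) :
    quadForm (spaceMatrix A) w = inner ℝ (A (spaceIncl w)) (spaceIncl w) := by
  set b : Fin n → Fin n → ℝ := fun i j =>
    inner ℝ (A (spaceIncl (EuclideanSpace.single i 1))) (spaceIncl (EuclideanSpace.single j 1))
    with hb
  have h1 : inner ℝ (A (spaceIncl w)) (spaceIncl w) = ∑ i, ∑ j, w i * w j * b j i := by
    rw [spaceIncl_eq_sum w]
    simp only [map_sum, map_smul, sum_inner, inner_sum, real_inner_smul_left, inner_smul_right]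
    refine Finset.sum_congr rfl fun i _ => ?_
    rw [Finset.mul_sum]
    refine Finset.sum_congr rfl fun j _ => ?_
    simp only [hb]; ring
  have h2 : quadForm (spaceMatrix A) w
      = 1 / 2 * (∑ i, ∑ j, w i * w j * b i j) + 1 / 2 * (∑ i, ∑ j, w i * w j * b j i) := by
    rw [quadForm_eq_sum, Finset.mul_sum, Finset.mul_sum, ← Finset.sum_add_distrib]
    refine Finset.sum_congr rfl fun i _ => ?_
    rw [Finset.sum_mul, Finset.mul_sum, Finset.mul_sum, ← Finset.sum_add_distrib]
    refine Finset.sum_congr rfl fun j _ => ?_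
    simp only [spaceMatrix, Matrix.of_apply, hb]; ring
  have h3 : ∑ i, ∑ j, w i * w j * b j i = ∑ i, ∑ j, w i * w j * b i j := by
    rw [Finset.sum_comm]
    exact Finset.sum_congr rfl fun i _ => Finset.sum_congr rfl fun j _ => by ring
  rw [h2, h1, h3]; ring

/-- Every second order term involving time is `O(‖h‖ |h.fst|)`, hence `o(|s - t|)`; a parabolic jet
retains only the spatial block. -/
lemma inner_eq_space_add_le (A : TimeSpace n →L[ℝ] TimeSpace n) (h : TimeSpace n) :
    inner ℝ (A h) h ≤ inner ℝ (A (spaceIncl h.snd)) (spaceIncl h.snd)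
      + 2 * (‖A‖ * ‖h‖) * |h.fst| := by
  set w : TimeSpace n := spaceIncl h.snd with hw
  set σ : TimeSpace n := WithLp.toLp 2 (h.fst, 0) with hσ
  have hdec : h = σ + w := by
    refine WithLp.ofLp_injective 2 (Prod.ext ?_ ?_) <;> simp [hσ, hw, spaceIncl]
  have hσn : ‖σ‖ = |h.fst| := WithLp.norm_toLp_fst 2 ℝ (Vec n) h.fst
  have hwn : ‖w‖ ≤ ‖h‖ := by
    rw [hw, norm_spaceIncl]; exact WithLp.norm_snd_le _ _
  have e : inner ℝ (A h) h = inner ℝ (A w) w + inner ℝ (A σ) h + inner ℝ (A w) σ := by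
    conv_lhs => rw [hdec]
    conv_rhs => rw [hdec]
    simp only [map_add, inner_add_left, inner_add_right]
    ring
  have h1 : inner ℝ (A σ) h ≤ ‖A‖ * ‖h‖ * |h.fst| := by
    refine (real_inner_le_norm _ _).trans ?_
    calc ‖A σ‖ * ‖h‖ ≤ ‖A‖ * ‖σ‖ * ‖h‖ := by gcongr; exact A.le_opNorm _
      _ = _ := by rw [hσn]; ring
  have h2 : inner ℝ (A w) σ ≤ ‖A‖ * ‖h‖ * |h.fst| := by
    refine (real_inner_le_norm _ _).trans ?_
    rw [hσn]; gcongr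
    exact (A.le_opNorm _).trans (by gcongr)
  rw [e]; linarith

/-- A second order expansion in time-space yields an element of the parabolic superjet. -/
lemma mem_superjet_of_expansion {u : ℝ → Vec n → ℝ} {K : Set (TimeSpace n)} {z p : TimeSpace n}
    (hK : K ∈ 𝓝 z) {A : TimeSpace n →L[ℝ] TimeSpace n}
    (hexp : ∀ ε : ℝ, 0 < ε → ∀ᶠ h in 𝓝 (0 : TimeSpace n), z + h ∈ K →
      u (z + h).fst (z + h).snd ≤ u z.fst z.snd + inner ℝ p h + 1 / 2 * inner ℝ (A h) h
        + ε * ‖h‖ ^ 2) :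
    (p.fst, p.snd, spaceMatrix A) ∈ superjet u z.fst z.snd := by
  refine ⟨spaceMatrix_isSymm A, fun ε hε => ?_⟩
  have hshift : Tendsto (fun h : TimeSpace n => z + h) (𝓝 0) (𝓝 z) := by
    have : Continuous fun h : TimeSpace n => z + h := by fun_prop
    simpa using this.tendsto 0
  have hsmall : ∀ᶠ h in 𝓝 (0 : TimeSpace n), ‖A‖ * ‖h‖ < ε / 2 := by
    have : Continuous fun h : TimeSpace n => ‖A‖ * ‖h‖ := by fun_prop
    have := this.tendsto 0
    rw [norm_zero, mul_zero] at this
    exact this.eventually (gt_mem_nhds (by positivity))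
  have hone : ∀ᶠ h in 𝓝 (0 : TimeSpace n), ‖h‖ < 1 := by
    have : Tendsto (fun h : TimeSpace n => ‖h‖) (𝓝 0) (𝓝 0) := tendsto_norm_zero
    exact this.eventually (gt_mem_nhds one_pos)
  have hinc : Tendsto (fun y : ℝ × Vec n =>
      (WithLp.toLp 2 (y.1 - z.fst, y.2 - z.snd) : TimeSpace n)) (𝓝 (z.fst, z.snd)) (𝓝 0) := by
    have : Continuous fun y : ℝ × Vec n =>
        (WithLp.toLp 2 (y.1 - z.fst, y.2 - z.snd) : TimeSpace n) :=
      (WithLp.prod_continuous_toLp 2 ℝ (Vec n)).comp (by fun_prop)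
    have := this.tendsto (z.fst, z.snd)
    simp only [sub_self] at this
    exact this
  filter_upwards [hinc.eventually (((hexp (ε / 2) (by positivity)).and (hshift.eventually hK)).and
    (hsmall.and hone))] with y hy
  obtain ⟨⟨h1, h2⟩, h3, h4⟩ := hy
  set h : TimeSpace n := WithLp.toLp 2 (y.1 - z.fst, y.2 - z.snd) with hh
  have hf : h.fst = y.1 - z.fst := rfl
  have hs : h.snd = y.2 - z.snd := rfl
  have h5 := h1 h2
  rw [WithLp.add_fst, WithLp.add_snd, hf, hs, add_sub_cancel, add_sub_cancel] at h5
  have h6 := inner_eq_space_add_le A h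
  rw [← quadForm_spaceMatrix, hs, hf] at h6
  have h7 : inner ℝ p h = p.fst * (y.1 - z.fst) + inner ℝ p.snd (y.2 - z.snd) := by
    rw [WithLp.prod_inner_apply]
    change (y.1 - z.fst) * p.fst + _ = _
    rw [mul_comm]; rfl
  -- For `‖h‖ < 1` the squared time increment is at most the increment itself.
  have h8 : ‖h‖ ^ 2 ≤ |y.1 - z.fst| + ‖y.2 - z.snd‖ ^ 2 := by
    have h9 : |h.fst| ≤ 1 := (WithLp.norm_fst_le _ h).trans h4.le
    rw [WithLp.prod_norm_sq_eq_of_L2, hs, Real.norm_eq_abs, ← hf]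
    have := mul_le_of_le_one_left (abs_nonneg h.fst) h9
    nlinarith
  have h10 : ‖A‖ * ‖h‖ * |y.1 - z.fst| ≤ ε / 2 * |y.1 - z.fst| := by gcongr
  have h11 : ε / 2 * ‖h‖ ^ 2 ≤ ε / 2 * (|y.1 - z.fst| + ‖y.2 - z.snd‖ ^ 2) := by gcongr
  have h12 : 0 ≤ ε / 2 * ‖y.2 - z.snd‖ ^ 2 := by positivity
  rw [h7] at h5
  linarith

lemma mem_subjet_of_expansion {v : ℝ → Vec n → ℝ} {K : Set (TimeSpace n)} {z p : TimeSpace n}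
    (hK : K ∈ 𝓝 z) {A : TimeSpace n →L[ℝ] TimeSpace n}
    (hexp : ∀ ε : ℝ, 0 < ε → ∀ᶠ h in 𝓝 (0 : TimeSpace n), z + h ∈ K →
      v z.fst z.snd + inner ℝ p h + 1 / 2 * inner ℝ (A h) h - ε * ‖h‖ ^ 2
        ≤ v (z + h).fst (z + h).snd) :
    (p.fst, p.snd, spaceMatrix A) ∈ subjet v z.fst z.snd := by
  have := mem_superjet_of_expansion (u := fun s y => -v s y) (p := -p) (A := -A) hK
    fun ε hε => by
      filter_upwards [hexp ε hε] with h hh hK'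
      have := hh hK'
      simp only [inner_neg_left, neg_apply]
      linarith
  rw [spaceMatrix_neg] at this
  exact this

end Jets

/-! ### The penalty function and its jets. -/

section Penalty

variable {n : ℕ}

/-- A quantitative second order upper bound whose coefficients carry the weight `(1 + |x|²)^k`;
multiplied by `(1 + |x|)²`, this weight remains comparable to the penalty. -/
lemma one_add_norm_sq_pow_le (k : ℕ) : ∃ C : ℝ, 0 ≤ C ∧ ∀ x h : Vec n, ‖h‖ ≤ 1 →
    (1 + ‖x + h‖ ^ 2) ^ (k + 1) ≤ (1 + ‖x‖ ^ 2) ^ (k + 1)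
      + 2 * (k + 1) * (1 + ‖x‖ ^ 2) ^ k * inner ℝ x h + C * (1 + ‖x‖ ^ 2) ^ k * ‖h‖ ^ 2 := by
  induction k with
  | zero =>
    refine ⟨1, zero_le_one, fun x h _ => ?_⟩
    rw [norm_add_sq_real]
    simp only [zero_add, pow_one, pow_zero, Nat.cast_zero]
    linarith
  | succ k ih =>
    obtain ⟨C, hC, ih⟩ := ih
    -- With `i = ⟪x, h⟫`, `s = ‖h‖²` and `a = 1 + ‖x‖²`, the remainder terms of the product are
    -- bounded through `i² ≤ a s`, `i s ≤ a s` and `s² ≤ a s`.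
    refine ⟨1 + 4 * C + 6 * (k + 1), by positivity, fun x h hh => ?_⟩
    have h0 := ih x h hh
    set a := 1 + ‖x‖ ^ 2 with ha
    have ha1 : 1 ≤ a := by nlinarith [sq_nonneg ‖x‖]
    set i := inner ℝ x h with hi
    have hxa : ‖x‖ ≤ a := by nlinarith [sq_nonneg (‖x‖ - 1)]
    have hi1 : |i| ≤ a * ‖h‖ := (abs_real_inner_le_norm x h).trans (by gcongr)
    have hi1' : i ≤ a := (le_abs_self _).trans (hi1.trans (by
      have := mul_le_mul_of_nonneg_left hh (by linarith : 0 ≤ a); linarith))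
    have hi2 : i ^ 2 ≤ a * ‖h‖ ^ 2 := by
      have h1 : |i| ^ 2 ≤ (‖x‖ * ‖h‖) ^ 2 := by gcongr; exact abs_real_inner_le_norm x h
      rw [sq_abs, mul_pow] at h1
      refine h1.trans ?_
      gcongr; linarith
    have hs : 0 ≤ ‖h‖ ^ 2 := sq_nonneg _
    have hs1 : ‖h‖ ^ 2 ≤ a := by
      have : ‖h‖ ^ 2 ≤ 1 ^ 2 := by gcongr
      linarith
    have he : 1 + ‖x + h‖ ^ 2 = a + 2 * i + ‖h‖ ^ 2 := by
      rw [norm_add_sq_real]; ring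
    have hpos : 0 ≤ a + 2 * i + ‖h‖ ^ 2 := by rw [← he]; positivity
    rw [he] at h0 ⊢
    rw [pow_succ']
    refine (mul_le_mul_of_nonneg_left h0 hpos).trans ?_
    have hP : 0 ≤ a ^ k := by positivity
    set s := ‖h‖ ^ 2
    have e : a ^ (k + 1) = a * a ^ k := pow_succ' _ _
    have e2 : a ^ (k + 1 + 1) = a ^ 2 * a ^ k := by ring
    rw [e2, e]
    push_cast
    have hk : (0 : ℝ) ≤ k + 1 := by positivity
    have m1 : i * s ≤ a * s := mul_le_mul_of_nonneg_right hi1' hs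
    have m2 : s * s ≤ a * s := mul_le_mul_of_nonneg_right hs1 hs
    have key : (a + 2 * i + s) * (a + 2 * (k + 1) * i + C * s)
        ≤ a ^ 2 + 2 * (k + 1 + 1) * a * i + (1 + 4 * C + 6 * (k + 1)) * a * s := by
      have t1 := mul_le_mul_of_nonneg_left hi2 hk
      have t2 := mul_le_mul_of_nonneg_left m1 hk
      have t3 := mul_le_mul_of_nonneg_left m1 hC
      have t4 := mul_le_mul_of_nonneg_left m2 hC
      nlinarith
    have := mul_le_mul_of_nonneg_right key hP
    refine le_trans (le_of_eq ?_) (this.trans (le_of_eq ?_)) <;> ring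

/-- The penalty function: it blows up at time `0` and at infinity. -/
noncomputable def penalty (lam T : ℝ) (k : ℕ) (t : ℝ) (x : Vec n) : ℝ :=
  Real.exp (lam * (T - t)) * ((1 + ‖x‖ ^ 2) ^ (k + 1) + 1 / t)

lemma penalty_pos (lam T : ℝ) (k : ℕ) {t : ℝ} (ht : 0 < t) (x : Vec n) :
    0 < penalty lam T k t x := by
  unfold penalty; positivity

/-- The penalty has a superjet whose time component is very negative, and whose space components
are controlled by the penalty independently of the exponential rate. -/
lemma exists_mem_superjet_penalty (k : ℕ) : ∃ B : ℝ, 0 ≤ B ∧ ∀ (lam T t : ℝ) (x : Vec n), 0 < t →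
    ∃ (p : ℝ) (q : Vec n) (κ : ℝ),
      (p, q, κ • (1 : Matrix (Fin n) (Fin n) ℝ)) ∈ superjet (penalty lam T k) t x ∧
      p ≤ -(lam * penalty lam T k t x) ∧ 0 ≤ κ ∧
      κ * (1 + ‖x‖) ^ 2 + ‖q‖ * (1 + ‖x‖) ≤ B * penalty lam T k t x := by
  obtain ⟨C, hC, hpow⟩ := one_add_norm_sq_pow_le (n := n) k
  refine ⟨4 * C + 4 * (k + 1), by positivity, fun lam T t x ht => ?_⟩
  set a := 1 + ‖x‖ ^ 2 with ha
  have ha0 : 0 < a := by positivity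
  set θ : ℝ → ℝ := fun s => Real.exp (lam * (T - s)) with hθ
  have hθ0 : ∀ s, 0 < θ s := fun s => Real.exp_pos _
  set ψ : Vec n → ℝ := fun y => (1 + ‖y‖ ^ 2) ^ (k + 1) with hψ
  have hθd : HasDerivAt θ (-(lam * θ t)) t := by
    have h1 : HasDerivAt (fun s => lam * (T - s)) (-lam) t := by
      simpa using ((hasDerivAt_id t).const_sub T).const_mul lam
    exact h1.exp.congr_deriv (by simp only [hθ]; ring)
  have hgd : HasDerivAt (fun s => θ s * (ψ x + 1 / s))
      (-(lam * penalty lam T k t x) - θ t / t ^ 2) t := by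
    have h1 : HasDerivAt (fun s : ℝ => ψ x + 1 / s) (-1 / t ^ 2) t := by
      have := (hasDerivAt_inv ht.ne').const_add (ψ x)
      simpa [one_div, neg_div] using this
    refine (hθd.mul h1).congr_deriv ?_
    simp only [penalty, hθ, hψ]; ring
  refine ⟨-(lam * penalty lam T k t x) - θ t / t ^ 2, (θ t * (2 * (k + 1) * a ^ k)) • x,
    θ t * (2 * C * a ^ k), ⟨Matrix.isSymm_one.smul _, fun ε hε => ?_⟩, ?_, ?_, ?_⟩
  · have e1 := hgd.isLittleO.def (show (0 : ℝ) < ε / 2 by positivity)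
    have e2 := hθd.isLittleO.def one_pos
    set Λ := |lam * θ t| + 1 with hΛ
    have hΛ0 : 0 < Λ := by positivity
    have hψc : Continuous ψ := by simp only [hψ]; fun_prop
    have e3 : ∀ᶠ y in 𝓝 x, |ψ y - ψ x| < ε / (2 * Λ) := by
      have : Tendsto (fun y => |ψ y - ψ x|) (𝓝 x) (𝓝 0) := by
        have : Continuous fun y => |ψ y - ψ x| := by fun_prop
        simpa using this.tendsto x
      exact this.eventually (gt_mem_nhds (by positivity))
    have e4 : ∀ᶠ y in 𝓝 x, ‖y - x‖ < 1 := by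
      have : Tendsto (fun y => ‖y - x‖) (𝓝 x) (𝓝 0) := by
        have : Continuous fun y : Vec n => ‖y - x‖ := by fun_prop
        simpa using this.tendsto x
      exact this.eventually (gt_mem_nhds one_pos)
    rw [nhds_prod_eq]
    filter_upwards [(e1.and e2).prod_mk (e3.and e4)] with z hz
    obtain ⟨⟨h1, h2⟩, h3, h4⟩ := hz
    have h5 := hpow x (z.2 - x) h4.le
    rw [add_sub_cancel] at h5
    change ψ z.2 ≤ ψ x + _ + _ at h5
    have h6 := (abs_le.1 (by simpa [Real.norm_eq_abs] using h1 : |_| ≤ _)).2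
    have h7 : |θ z.1 - θ t| ≤ Λ * |z.1 - t| := by
      have h8 : |θ z.1 - θ t - (z.1 - t) * -(lam * θ t)| ≤ |z.1 - t| := by
        simpa [Real.norm_eq_abs] using h2
      have h9 : θ z.1 - θ t = (θ z.1 - θ t - (z.1 - t) * -(lam * θ t))
          + (z.1 - t) * -(lam * θ t) := by ring
      rw [h9]
      refine (abs_add_le _ _).trans ?_
      rw [abs_mul (z.1 - t), abs_neg, hΛ]
      linarith
    -- The mixed term is `o(|s - t|)`: `θ` has increments `O(|s - t|)` and `ψ` is continuous.
    have h10 : (θ z.1 - θ t) * (ψ z.2 - ψ x) ≤ ε / 2 * |z.1 - t| := by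
      refine (le_abs_self _).trans ?_
      rw [abs_mul]
      calc |θ z.1 - θ t| * |ψ z.2 - ψ x| ≤ Λ * |z.1 - t| * (ε / (2 * Λ)) := by gcongr
        _ = _ := by field_simp
    have h11 := mul_le_mul_of_nonneg_left h5 (hθ0 t).le
    have h12 : penalty lam T k z.1 z.2 = θ z.1 * (ψ x + 1 / z.1) + θ t * ψ z.2 - θ t * ψ x
        + (θ z.1 - θ t) * (ψ z.2 - ψ x) := by
      simp only [penalty, hθ, hψ]; ring
    have h13 : penalty lam T k t x = θ t * (ψ x + 1 / t) := rfl
    have h14 : 0 ≤ ε / 2 * |z.1 - t| := by positivity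
    have h15 : 0 ≤ ε * ‖z.2 - x‖ ^ 2 := by positivity
    rw [h12, quadForm_smul_one, real_inner_smul_left]
    simp only [one_div] at h6 h11 h13 ⊢
    rw [h13] at h6 ⊢
    linarith
  · have : 0 < θ t / t ^ 2 := by have := hθ0 t; positivity
    linarith
  · have := hθ0 t; positivity
  · have h1 : (1 + ‖x‖) ^ 2 ≤ 2 * a := by rw [ha]; nlinarith [sq_nonneg (‖x‖ - 1)]
    have h2 : ‖x‖ * (1 + ‖x‖) ≤ 2 * a := by rw [ha]; nlinarith [sq_nonneg (‖x‖ - 1)]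
    have hθt := hθ0 t
    rw [norm_smul, Real.norm_of_nonneg (by positivity)]
    have h3 : penalty lam T k t x = θ t * a ^ k * a + θ t / t := by
      simp only [penalty, hθ, ha]; ring
    rw [h3]
    have h4 := mul_le_mul_of_nonneg_left h1 (show 0 ≤ θ t * (2 * C * a ^ k) by positivity)
    have h5 := mul_le_mul_of_nonneg_left h2 (show 0 ≤ θ t * (2 * (k + 1) * a ^ k) by positivity)
    have h6 : 0 ≤ (4 * C + 4 * (k + 1)) * (θ t / t) := by positivity
    nlinarith

end Penalty

/-! ### Contact with the penalty and the inequality between jets. -/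

section Comparison

variable {n d : ℕ}

/-- A smooth weight whose exponent may be enlarged, so that two functions can share one exponent. -/
lemma PolynomialGrowth.exists_bound {T : ℝ} {u : ℝ → Vec n → ℝ} (hu : PolynomialGrowth T u) :
    ∃ (C : ℝ) (k : ℕ), 0 ≤ C ∧ ∀ l : ℕ, k ≤ l → ∀ t : ℝ, 0 ≤ t → t ≤ T → ∀ x : Vec n,
      |u t x| ≤ C * (1 + ‖x‖ ^ 2) ^ l := by
  obtain ⟨C, k, h⟩ := hu
  refine ⟨2 * |C|, k, by positivity, fun l hl t h0 hT x => (h t h0 hT x).trans ?_⟩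
  have h1 : 1 ≤ 1 + ‖x‖ ^ 2 := by nlinarith [sq_nonneg ‖x‖]
  have h2 : ‖x‖ ^ k ≤ (1 + ‖x‖ ^ 2) ^ k := by
    gcongr; nlinarith [sq_nonneg (‖x‖ - 1)]
  have h3 : (1 : ℝ) ≤ (1 + ‖x‖ ^ 2) ^ l := one_le_pow₀ h1
  have h4 : (1 + ‖x‖ ^ 2) ^ k ≤ (1 + ‖x‖ ^ 2) ^ l := pow_le_pow_right₀ h1 hl
  calc C * (1 + ‖x‖ ^ k) ≤ |C| * (1 + ‖x‖ ^ k) := by gcongr; exact le_abs_self C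
    _ ≤ |C| * ((1 + ‖x‖ ^ 2) ^ l + (1 + ‖x‖ ^ 2) ^ l) := by gcongr; exact h2.trans h4
    _ = _ := by ring

/-- A compact cylinder in time-space. -/
def cylinder (n : ℕ) (τ T R : ℝ) : Set (TimeSpace n) :=
  {z | (τ ≤ z.fst ∧ z.fst ≤ T) ∧ ‖z.snd‖ ≤ R}

lemma continuous_timeSpace_fst : Continuous fun z : TimeSpace n => z.fst :=
  (WithLp.prod_continuous_ofLp 2 ℝ (Vec n)).fst

lemma continuous_timeSpace_snd : Continuous fun z : TimeSpace n => z.snd :=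
  (WithLp.prod_continuous_ofLp 2 ℝ (Vec n)).snd

lemma isCompact_cylinder (τ T R : ℝ) : IsCompact (cylinder n τ T R) := by
  have h : IsCompact (Set.Icc τ T ×ˢ Metric.closedBall (0 : Vec n) R) :=
    isCompact_Icc.prod (isCompact_closedBall _ _)
  have h2 := h.image (WithLp.prod_continuous_toLp 2 ℝ (Vec n))
  convert h2 using 1
  ext z
  constructor
  · rintro ⟨h1, h2⟩
    exact ⟨(z.fst, z.snd), ⟨h1, by simpa using h2⟩, rfl⟩
  · rintro ⟨⟨t, x⟩, ⟨h1, h2⟩, rfl⟩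
    exact ⟨h1, by simpa using h2⟩

lemma cylinder_mem_nhds {τ T R : ℝ} {z : TimeSpace n} (h1 : τ < z.fst) (h2 : z.fst < T)
    (h3 : ‖z.snd‖ < R) : cylinder n τ T R ∈ 𝓝 z := by
  have c1 := (continuous_timeSpace_fst (n := n)).tendsto z
  have c2 := (continuous_timeSpace_snd (n := n)).norm.tendsto z
  filter_upwards [c1.eventually (lt_mem_nhds h1), c1.eventually (gt_mem_nhds h2),
    c2.eventually (gt_mem_nhds h3)] with w a b c
  exact ⟨⟨a.le, b.le⟩, c.le⟩

lemma continuousOn_cylinder {T τ R : ℝ} (hτ : 0 < τ) {u : ℝ → Vec n → ℝ}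
    (hu : ContinuousOn (fun q : ℝ × Vec n => u q.1 q.2) (strip n T)) :
    ContinuousOn (fun z : TimeSpace n => u z.fst z.snd) (cylinder n τ T R) :=
  hu.comp (f := fun z : TimeSpace n => (z.fst, z.snd))
    (continuous_timeSpace_fst.prodMk continuous_timeSpace_snd).continuousOn
    fun _ hz => ⟨hτ.le.trans hz.1.1, hz.1.2⟩

lemma continuousOn_penalty {T τ R : ℝ} (hτ : 0 < τ) (lam : ℝ) (k : ℕ) :
    ContinuousOn (fun z : TimeSpace n => penalty lam T k z.fst z.snd) (cylinder n τ T R) := by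
  have c1 := continuous_timeSpace_fst (n := n)
  have c2 := continuous_timeSpace_snd (n := n)
  unfold penalty
  refine ContinuousOn.mul (Continuous.continuousOn (by fun_prop)) (ContinuousOn.add
    (Continuous.continuousOn (by fun_prop)) ?_)
  exact continuousOn_const.div c1.continuousOn fun z hz => (hτ.trans_le hz.1.1).ne'

/-- If `u > v` somewhere, then a multiple of the penalty touches `u - v` from above, and all the
contact points lie in the interior of a compact cylinder. -/
lemma exists_penalty_contact {T lam : ℝ} (hlam : 0 ≤ lam) {k : ℕ} {u v : ℝ → Vec n → ℝ}
    (hu : ContinuousOn (fun q : ℝ × Vec n => u q.1 q.2) (strip n T))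
    (hv : ContinuousOn (fun q : ℝ × Vec n => v q.1 q.2) (strip n T))
    {C : ℝ} (hC : 0 ≤ C) (hgrowth : ∀ t : ℝ, 0 ≤ t → t ≤ T → ∀ x : Vec n,
      u t x - v t x ≤ C * (1 + ‖x‖ ^ 2) ^ k)
    (hterm : ∀ x, u T x ≤ v T x) {t₀ : ℝ} {x₀ : Vec n} (ht₀ : 0 < t₀) (ht₀T : t₀ ≤ T)
    (hlt : v t₀ x₀ < u t₀ x₀) :
    ∃ δ τ R : ℝ, 0 < δ ∧ 0 < τ ∧
      (∀ z ∈ cylinder n τ T R,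
        u z.fst z.snd - v z.fst z.snd ≤ δ * penalty lam T k z.fst z.snd) ∧
      (∃ z ∈ cylinder n τ T R,
        u z.fst z.snd - v z.fst z.snd = δ * penalty lam T k z.fst z.snd) ∧
      ∀ z ∈ cylinder n τ T R,
        u z.fst z.snd - v z.fst z.snd = δ * penalty lam T k z.fst z.snd →
        τ < z.fst ∧ z.fst < T ∧ ‖z.snd‖ < R := by
  -- The final `δ` is the maximum of the ratio `(u - v) / penalty`, hence at least `ρ₀`. The
  -- constants `R` and `τ` keep the ratio below `ρ₀` for `‖x‖ ≥ R`, by the extra power of `1 +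
  -- ‖x‖²`, and for `t ≤ τ`, by the term `1 / t`.
  set ρ₀ := (u t₀ x₀ - v t₀ x₀) / penalty lam T k t₀ x₀ with hρ₀
  have hρ₀0 : 0 < ρ₀ := div_pos (by linarith) (penalty_pos _ _ _ ht₀ _)
  set R := C / ρ₀ + 1 with hR
  have hR1 : 1 ≤ R := by have : 0 ≤ C / ρ₀ := by positivity
                         linarith
  set Q := C * (1 + R ^ 2) ^ k with hQ
  have hQ0 : 0 ≤ Q := by positivity
  set τ := ρ₀ / (Q + 1) with hτdef
  have hτ : 0 < τ := by positivity
  have hlow : ∀ t, 0 < t → t ≤ T → ∀ x : Vec n,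
      (1 + ‖x‖ ^ 2) ^ (k + 1) + 1 / t ≤ penalty lam T k t x := by
    intro t h0 hT x
    refine le_mul_of_one_le_left (by positivity) (Real.one_le_exp ?_)
    exact mul_nonneg hlam (by linarith)
  have hout : ∀ t, 0 < t → t ≤ T → ∀ x : Vec n, (t ≤ τ ∨ t = T ∨ R ≤ ‖x‖) →
      u t x - v t x < ρ₀ * penalty lam T k t x := by
    intro t h0 hT x hcases
    have hpp := mul_pos hρ₀0 (penalty_pos lam T k h0 x)
    have hp := mul_le_mul_of_nonneg_left (hlow t h0 hT x) hρ₀0.le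
    have hg := hgrowth t h0.le hT x
    by_cases hx : R ≤ ‖x‖
    · have h1 : C < ρ₀ * (1 + ‖x‖ ^ 2) := by
        have : C / ρ₀ < 1 + ‖x‖ ^ 2 := by nlinarith
        rw [div_lt_iff₀ hρ₀0] at this; linarith
      have h2 : C * (1 + ‖x‖ ^ 2) ^ k < ρ₀ * (1 + ‖x‖ ^ 2) ^ (k + 1) := by
        rw [pow_succ' (1 + ‖x‖ ^ 2) k, ← mul_assoc]
        exact mul_lt_mul_of_pos_right h1 (by positivity)
      have h3 : 0 < ρ₀ * (1 / t) := by positivity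
      linarith
    · rcases hcases with ht | ht | ht
      · have h1 : C * (1 + ‖x‖ ^ 2) ^ k ≤ Q := by
          rw [hQ]
          have := (not_le.1 hx).le
          gcongr
        have h2 : Q < ρ₀ * (1 / t) := by
          have h4 : t * (Q + 1) ≤ ρ₀ := by
            rwa [hτdef, le_div_iff₀ (by positivity)] at ht
          rw [mul_one_div, lt_div_iff₀ h0]
          nlinarith
        have h3 : 0 < ρ₀ * (1 + ‖x‖ ^ 2) ^ (k + 1) := by positivity
        linarith
      · subst ht
        linarith [hterm x]
      · exact absurd ht hx
  have hin : ∀ z ∈ cylinder n τ T R, 0 < penalty lam T k z.fst z.snd :=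
    fun z hz => penalty_pos _ _ _ (hτ.trans_le hz.1.1) _
  have hz₀ : (WithLp.toLp 2 (t₀, x₀) : TimeSpace n) ∈ cylinder n τ T R := by
    have key : ¬(t₀ ≤ τ ∨ t₀ = T ∨ R ≤ ‖x₀‖) := by
      intro h
      have := hout t₀ ht₀ ht₀T x₀ h
      rw [hρ₀, div_mul_cancel₀ _ (penalty_pos _ _ _ ht₀ _).ne'] at this
      exact lt_irrefl _ this
    push Not at key
    exact ⟨⟨key.1.le, ht₀T⟩, key.2.2.le⟩
  obtain ⟨z, hz, hmax⟩ := (isCompact_cylinder (n := n) τ T R).exists_isMaxOn ⟨_, hz₀⟩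
    (((continuousOn_cylinder (R := R) hτ hu).sub (continuousOn_cylinder hτ hv)).div
      (continuousOn_penalty hτ lam k) fun z hz => (hin z hz).ne')
  set δ := (u z.fst z.snd - v z.fst z.snd) / penalty lam T k z.fst z.snd with hδ
  have hδρ : ρ₀ ≤ δ := hmax hz₀
  refine ⟨δ, τ, R, hρ₀0.trans_le hδρ, hτ, fun y hy => ?_, ⟨z, hz, ?_⟩, fun y hy he => ?_⟩
  · rw [← div_le_iff₀ (hin y hy)]
    exact hmax hy
  · rw [hδ, div_mul_cancel₀ _ (hin z hz).ne']
  · have key : ¬(y.fst ≤ τ ∨ y.fst = T ∨ R ≤ ‖y.snd‖) := by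
      intro h
      have h1 := hout y.fst (hτ.trans_le hy.1.1) hy.1.2 y.snd h
      have h2 := mul_le_mul_of_nonneg_right hδρ (hin y hy).le
      linarith
    push Not at key
    exact ⟨key.1, lt_of_le_of_ne hy.1.2 key.2.1, key.2.2⟩

/-- The estimate obtained from the equations at a pair of jets. -/
lemma jet_estimate {c : Coefficients n d} {T : ℝ} (hc : c.Standing T) (havg : c.HasAverage)
    {C : ℝ} {m : ℕ}
    (hF : ∀ r : ℝ, 0 ≤ r → ∀ (x₁ x₂ : Vec n) (y₁ y₂ : ℝ) (q₁ q₂ : Vec n)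
      (X₁ X₂ : Matrix (Fin n) (Fin n) ℝ) (α κ : ℝ), X₁.IsSymm → X₂.IsSymm → 0 ≤ α → 0 ≤ κ →
      (∀ w₁ w₂, quadForm X₁ w₁ - quadForm X₂ w₂ ≤ α * ‖w₁ - w₂‖ ^ 2 + κ * ‖w₁‖ ^ 2) →
      c.F r x₁ y₁ q₁ X₁ - c.F r x₂ y₂ q₂ X₂ ≤ C * modulus m α κ x₁ x₂ y₁ y₂ q₁ q₂)
    {u v : ℝ → Vec n → ℝ} (hu : c.IsViscositySubsolution T u)
    (hv : c.IsViscositySupersolution T v) {t₁ t₂ : ℝ} {x₁ x₂ : Vec n}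
    (ht₁ : 0 < t₁) (ht₁T : t₁ < T) (ht₂ : 0 < t₂) (ht₂T : t₂ < T)
    (hobst : c.S t₁ x₁ < u t₁ x₁) {α κ a₁ a₂ : ℝ} (hα : 0 ≤ α) (hκ : 0 ≤ κ) {q₁ q₂ : Vec n}
    {X₁ X₂ : Matrix (Fin n) (Fin n) ℝ} (hj₁ : (a₁, q₁, X₁) ∈ superjet u t₁ x₁)
    (hj₂ : (a₂, q₂, X₂) ∈ subjet v t₂ x₂)
    (hX : ∀ w₁ w₂, quadForm X₁ w₁ - quadForm X₂ w₂ ≤ α * ‖w₁ - w₂‖ ^ 2 + κ * ‖w₁‖ ^ 2) :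
    a₂ - a₁ ≤ C * modulus m α κ x₁ x₂ (u t₁ x₁) (v t₂ x₂) q₁ q₂ := by
  have h1 := hu.jet t₁ x₁ ht₁ ht₁T a₁ q₁ X₁ hj₁
  have h2 := hv.jet t₂ x₂ ht₂ ht₂T a₂ q₂ X₂ hj₂
  have h3 : -a₁ - c.Fbar x₁ (u t₁ x₁) q₁ X₁ ≤ 0 := by
    rcases min_le_iff.1 h1 with h | h
    · linarith
    · exact h
  have h4 := (le_min_iff.1 h2).2
  have hX₂ : X₂.IsSymm := by
    have := hj₂.1.neg
    simpa using this
  have h5 := c.Fbar_sub_le hc havg hj₁.1 hX₂ fun r hr =>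
    hF r hr x₁ x₂ (u t₁ x₁) (v t₂ x₂) q₁ q₂ X₁ X₂ α κ hj₁.1 hX₂ hα hκ hX
  linarith

end Comparison

/-! ### The comparison principle. -/

section Uniqueness

variable {n d : ℕ}

/-- The large vectors `α • e` cancel in the difference of the slopes; elsewhere they occur only in
`α ‖e‖ ‖x₁ - x₂‖`, which the doubling estimate controls. -/
lemma modulus_le {m : ℕ} {α κ δ η ε : ℝ} (hα : 0 ≤ α)
    {x₁ x₂ : Vec n} {y₁ y₂ : ℝ} {e p₁ p₂ q : Vec n} (hδ : 0 ≤ δ)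
    (hp₁ : ‖p₁ - α • e‖ ≤ η) (hp₂ : ‖p₂ - α • e‖ ≤ η)
    (he : α * (‖e‖ ^ 2 + ‖x₁ - x₂‖ ^ 2) ≤ ε) :
    modulus m α (δ * κ) x₁ x₂ y₁ y₂ (p₁ + δ • q) p₂ ≤
      δ * (κ * (1 + ‖x₁‖) ^ 2 + ‖q‖ * (1 + ‖x₁‖)) + 2 * ε + 2 * η * (1 + ‖x₁‖)
        + (η + 1 + ‖x₁‖ ^ m + ‖x₂‖ ^ m) * ‖x₁ - x₂‖ + |y₁ - y₂| := by
  have h1 : ‖p₁ + δ • q - p₂‖ ≤ 2 * η + δ * ‖q‖ := by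
    have e1 : p₁ + δ • q - p₂ = (p₁ - α • e) + -(p₂ - α • e) + δ • q := by abel
    rw [e1]
    refine norm_add₃_le.trans ?_
    rw [norm_neg, norm_smul, Real.norm_of_nonneg hδ]
    linarith
  have h2 : ‖p₂‖ ≤ η + α * ‖e‖ := by
    have e1 : p₂ = (p₂ - α • e) + α • e := by abel
    rw [e1]
    refine (norm_add_le _ _).trans ?_
    rw [norm_smul, Real.norm_of_nonneg hα]
    linarith
  have h3 := mul_le_mul_of_nonneg_right h1 (show 0 ≤ 1 + ‖x₁‖ by positivity)
  have h4 := mul_le_mul_of_nonneg_right h2 (norm_nonneg (x₁ - x₂))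
  have h5 : α * ‖e‖ * ‖x₁ - x₂‖ + α * ‖x₁ - x₂‖ ^ 2 ≤ 2 * ε := by
    have h6 := mul_nonneg hα (sq_nonneg (‖e‖ - ‖x₁ - x₂‖))
    have h7 := mul_nonneg hα (sq_nonneg ‖e‖)
    have h8 := mul_nonneg hα (sq_nonneg ‖x₁ - x₂‖)
    nlinarith
  unfold modulus
  linarith

/-- **Comparison principle** for the averaged obstacle problem, away from the initial time. -/
theorem comparison {T : ℝ} {c : Coefficients n d} (hc : c.Standing T)
    (hforward : c.LipschitzForward) (hbackward : c.LipschitzBackward) (havg : c.HasAverage)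
    {u v : ℝ → Vec n → ℝ} (hu : c.IsViscositySubsolution T u)
    (hv : c.IsViscositySupersolution T v) (hu_growth : PolynomialGrowth T u)
    (hv_growth : PolynomialGrowth T v) {t : ℝ} (ht : 0 < t) (htT : t ≤ T) (x : Vec n) :
    u t x ≤ v t x := by
  by_contra hcon
  rw [not_le] at hcon
  obtain ⟨Cu, ku, hCu, hgu⟩ := hu_growth.exists_bound
  obtain ⟨Cv, kv, hCv, hgv⟩ := hv_growth.exists_bound
  set k := max ku kv
  obtain ⟨C, m, hC, hF⟩ := c.F_sub_le hc.isG hc.h_symm hc.g_symm hforward hbackward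
  obtain ⟨B, hB, hpen⟩ := exists_mem_superjet_penalty (n := n) k
  -- `B` pays for the space derivatives of the penalty, and `1` for the Lipschitz dependence on the
  -- unknown, as `u - v = δ χ` at contact.
  set lam := C * (B + 1) + 1 with hlam
  have hlam0 : 0 ≤ lam := by positivity
  obtain ⟨δ, τ, R, hδ, hτ, hle, ⟨zc, hzc, hzceq⟩, hint⟩ := exists_penalty_contact hlam0 (k := k)
    hu.cont hv.cont (C := Cu + Cv) (by positivity)
    (fun s h0 hT y => by
      have h1 := (le_abs_self _).trans (hgu k (le_max_left _ _) s h0 hT y)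
      have h2 := (neg_le_abs _).trans (hgv k (le_max_right _ _) s h0 hT y)
      linarith)
    (fun y => (hu.terminal y).trans (hv.terminal y)) ht htT hcon
  set K := cylinder n τ T R with hKdef
  have hK : IsCompact K := isCompact_cylinder τ T R
  set χ : ℝ → Vec n → ℝ := penalty lam T k with hχ
  set U : TimeSpace n → ℝ := fun z => u z.fst z.snd - δ * χ z.fst z.snd with hUdef
  set V : TimeSpace n → ℝ := fun z => v z.fst z.snd with hVdef
  have hχc : ContinuousOn (fun z : TimeSpace n => χ z.fst z.snd) K := continuousOn_penalty hτ lam k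
  have huc : ContinuousOn (fun z : TimeSpace n => u z.fst z.snd) K :=
    continuousOn_cylinder hτ hu.cont
  have hSc : ContinuousOn (fun z : TimeSpace n => c.S z.fst z.snd) K :=
    continuousOn_cylinder hτ hc.cont_S
  have hUc : ContinuousOn U K := huc.sub (continuousOn_const.mul hχc)
  have hVc : ContinuousOn V K := continuousOn_cylinder hτ hv.cont
  set α : ℕ → ℝ := fun j => (j : ℝ) + 1 with hα
  set η : ℕ → ℝ := fun j => 1 / ((j : ℝ) + 1) with hη
  have hα0 : ∀ j, 0 < α j := fun j => by positivity
  have hη0 : ∀ j, 0 < η j := fun j => by positivity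
  choose z₁ hz₁ z₂ hz₂ e p₁ p₂ A₁ A₂ hp₁ hp₂ hmax hexp₁ hexp₂ hmat using fun j : ℕ =>
    exists_jets_of_doubling hK ⟨zc, hzc⟩ hUc hVc (hα0 j) (hη0 j)
  set w : ℕ → ℝ := fun j => ‖e j‖ ^ 2 + ‖z₁ j - z₂ j‖ ^ 2 with hw
  have hmax' : ∀ j, α j * w j ≤ 12 * (U (z₁ j) - V (z₂ j) + η j) := by
    intro j
    have h1 := hmax j zc hzc
    have h2 : U zc - V zc = 0 := by simp only [hUdef, hVdef]; linarith
    rw [h2] at h1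
    linarith
  have hηlim : Tendsto η atTop (𝓝 0) := tendsto_one_div_add_atTop_nhds_zero_nat
  obtain ⟨M, hM⟩ : ∃ M : ℝ, ∀ j, U (z₁ j) - V (z₂ j) ≤ M := by
    obtain ⟨M₁, h1⟩ := hK.bddAbove_image hUc
    obtain ⟨M₂, h2⟩ := hK.bddBelow_image hVc
    refine ⟨M₁ - M₂, fun j => ?_⟩
    have a := h1 ⟨z₁ j, hz₁ j, rfl⟩
    have b := h2 ⟨z₂ j, hz₂ j, rfl⟩
    linarith
  have hdist : Tendsto (fun j => z₁ j - z₂ j) atTop (𝓝 0) := by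
    have h1 : ∀ j, ‖z₁ j - z₂ j‖ ^ 2 ≤ 12 * (|M| + 1) * η j := by
      intro j
      have hηj : η j ≤ 1 := by
        simp only [hη]; rw [div_le_one (by positivity)]; linarith [Nat.cast_nonneg (α := ℝ) j]
      have h2 : α j * ‖z₁ j - z₂ j‖ ^ 2 ≤ 12 * (|M| + 1) := by
        have h3 := hmax' j
        have h4 : α j * ‖z₁ j - z₂ j‖ ^ 2 ≤ α j * w j := by
          have := (hα0 j).le
          gcongr
          simp only [hw]; linarith [sq_nonneg ‖e j‖]
        linarith [hM j, le_abs_self M]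
      simp only [hη]
      rw [mul_one_div, le_div_iff₀ (hα0 j)]
      linarith
    have h2 : Tendsto (fun j => 12 * (|M| + 1) * η j) atTop (𝓝 0) := by
      simpa using hηlim.const_mul (12 * (|M| + 1))
    have h3 := squeeze_zero (fun j => sq_nonneg ‖z₁ j - z₂ j‖) h1 h2
    have h4 := h3.sqrt
    simp only [Real.sqrt_sq (norm_nonneg _), Real.sqrt_zero] at h4
    exact tendsto_zero_iff_norm_tendsto_zero.2 h4
  obtain ⟨zb, hzb, φ, hφ, hlim₁⟩ := hK.tendsto_subseq hz₁
  have hlim₂ : Tendsto (z₂ ∘ φ) atTop (𝓝 zb) := by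
    have h1 := hlim₁.sub (hdist.comp hφ.tendsto_atTop)
    simp only [sub_zero] at h1
    refine h1.congr fun j => ?_
    simp
  have hηφ : Tendsto (fun j => η (φ j)) atTop (𝓝 0) := hηlim.comp hφ.tendsto_atTop
  have along₁ : ∀ {f : TimeSpace n → ℝ}, ContinuousOn f K →
      Tendsto (fun j => f (z₁ (φ j))) atTop (𝓝 (f zb)) := fun hf =>
    (hf zb hzb).tendsto.comp (tendsto_nhdsWithin_iff.2 ⟨hlim₁, Eventually.of_forall fun j => hz₁ _⟩)
  have along₂ : ∀ {f : TimeSpace n → ℝ}, ContinuousOn f K →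
      Tendsto (fun j => f (z₂ (φ j))) atTop (𝓝 (f zb)) := fun hf =>
    (hf zb hzb).tendsto.comp (tendsto_nhdsWithin_iff.2 ⟨hlim₂, Eventually.of_forall fun j => hz₂ _⟩)
  have hUV := (along₁ hUc).sub (along₂ hVc)
  have hzero : U zb - V zb = 0 := by
    refine le_antisymm ?_ ?_
    · have := hle zb hzb
      simp only [hUdef, hVdef]; linarith
    · have h1 : Tendsto (fun j => -η (φ j)) atTop (𝓝 0) := by simpa using hηφ.neg
      refine le_of_tendsto_of_tendsto' h1 hUV fun j => ?_
      have h2 := hmax' (φ j)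
      have h3 : 0 ≤ α (φ j) * w (φ j) := mul_nonneg (hα0 _).le (by positivity)
      linarith
  -- The limit of the doubled maxima is a contact point, hence interior, so both sequences of points
  -- eventually carry genuine jets.
  have hcontact : u zb.fst zb.snd - v zb.fst zb.snd = δ * χ zb.fst zb.snd := by
    simp only [hUdef, hVdef] at hzero; linarith
  obtain ⟨hb1, hb2, hb3⟩ := hint zb hzb hcontact
  set ω : ℕ → ℝ := fun j => 12 * (U (z₁ (φ j)) - V (z₂ (φ j)) + η (φ j)) with hω
  have hωlim : Tendsto ω atTop (𝓝 0) := by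
    have := (hUV.add hηφ).const_mul 12
    rw [hzero] at this
    simpa using this
  have c1 := continuous_timeSpace_fst (n := n)
  have c2 := continuous_timeSpace_snd (n := n)
  have hopen : ∀ {f : ℕ → TimeSpace n}, Tendsto f atTop (𝓝 zb) →
      ∀ᶠ j in atTop, τ < (f j).fst ∧ (f j).fst < T ∧ ‖(f j).snd‖ < R := fun hf =>
    (((c1.tendsto zb).comp hf).eventually (lt_mem_nhds hb1)).and
      ((((c1.tendsto zb).comp hf).eventually (gt_mem_nhds hb2)).and
        (((c2.norm.tendsto zb).comp hf).eventually (gt_mem_nhds hb3)))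
  have hχpos : 0 < χ zb.fst zb.snd := penalty_pos _ _ _ (hτ.trans hb1) _
  -- The equation gives `S ≤ v` only where `v` has a subjet, which may fail at `zb`; it holds at the
  -- approximating points and passes to the limit.
  have hSv : c.S zb.fst zb.snd ≤ v zb.fst zb.snd := by
    refine le_of_tendsto_of_tendsto (along₂ hSc) (along₂ hVc) ?_
    filter_upwards [hopen hlim₂] with j hj
    have hsub := mem_subjet_of_expansion (cylinder_mem_nhds hj.1 hj.2.1 hj.2.2) (hexp₂ (φ j))
    have := hv.jet _ _ (hτ.trans hj.1) hj.2.1 _ _ _ hsub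
    exact sub_nonneg.1 (le_min_iff.1 this).1
  have hSu : ∀ᶠ j in atTop, c.S (z₁ (φ j)).fst (z₁ (φ j)).snd < u (z₁ (φ j)).fst (z₁ (φ j)).snd := by
    refine (along₁ hSc).eventually_lt (along₁ huc) ?_
    have := mul_pos hδ hχpos
    linarith
  set X₁ : ℕ → Vec n := fun j => (z₁ (φ j)).snd with hX₁
  set X₂ : ℕ → Vec n := fun j => (z₂ (φ j)).snd with hX₂
  have key : ∀ᶠ j in atTop, lam * (δ * χ (z₁ (φ j)).fst (X₁ j)) - 2 * η (φ j) ≤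
      C * (B * (δ * χ (z₁ (φ j)).fst (X₁ j)) + 2 * ω j + 2 * η (φ j) * (1 + ‖X₁ j‖)
        + (η (φ j) + 1 + ‖X₁ j‖ ^ m + ‖X₂ j‖ ^ m) * ‖X₁ j - X₂ j‖
        + |u (z₁ (φ j)).fst (X₁ j) - v (z₂ (φ j)).fst (X₂ j)|) := by
    filter_upwards [hopen hlim₁, hopen hlim₂, hSu] with j hj₁ hj₂ hS
    obtain ⟨a, q, κ, hmem, ha, hκ, hbound⟩ := hpen lam T (z₁ (φ j)).fst (X₁ j) (hτ.trans hj₁.1)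
    have hsup := mem_superjet_of_expansion (u := fun s y => u s y - δ * χ s y)
      (cylinder_mem_nhds hj₁.1 hj₁.2.1 hj₁.2.2) (hexp₁ (φ j))
    have hsub := mem_subjet_of_expansion (cylinder_mem_nhds hj₂.1 hj₂.2.1 hj₂.2.2) (hexp₂ (φ j))
    have hadd := superjet_add hsup (superjet_const_mul hδ hmem)
    simp only [← hχ, sub_add_cancel] at hadd
    have hest := jet_estimate hc havg hF hu hv (hτ.trans hj₁.1) hj₁.2.1 (hτ.trans hj₂.1) hj₂.2.1
      hS (hα0 (φ j)).le (mul_nonneg hδ.le hκ) hadd hsub fun w₁ w₂ => by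
        rw [quadForm_add, quadForm_smul_one, quadForm_spaceMatrix, quadForm_spaceMatrix]
        have h1 := hmat (φ j) (spaceIncl w₁) (spaceIncl w₂)
        have h2 : spaceIncl w₁ - spaceIncl w₂ = (spaceIncl (w₁ - w₂) : TimeSpace n) := by
          simp only [spaceIncl]
          rw [← WithLp.toLp_sub, Prod.mk_sub_mk, sub_zero]
        rw [h2, norm_spaceIncl] at h1
        linarith
    have hfst : ∀ p : TimeSpace n, ‖p - α (φ j) • e (φ j)‖ ≤ η (φ j) →
        |p.fst - α (φ j) * (e (φ j)).fst| ≤ η (φ j) ∧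
        ‖p.snd - α (φ j) • (e (φ j)).snd‖ ≤ η (φ j) := fun p hp =>
      ⟨(WithLp.norm_fst_le _ (p - α (φ j) • e (φ j))).trans hp,
        (WithLp.norm_snd_le _ (p - α (φ j) • e (φ j))).trans hp⟩
    obtain ⟨f1, s1⟩ := hfst _ (hp₁ (φ j))
    obtain ⟨f2, s2⟩ := hfst _ (hp₂ (φ j))
    have hes : α (φ j) * (‖(e (φ j)).snd‖ ^ 2 + ‖X₁ j - X₂ j‖ ^ 2) ≤ ω j := by
      refine le_trans ?_ (hmax' (φ j))
      have := (hα0 (φ j)).le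
      simp only [hw]
      gcongr
      · exact WithLp.norm_snd_le _ _
      · exact WithLp.norm_snd_le _ (z₁ (φ j) - z₂ (φ j))
    have hmod := modulus_le (m := m) (κ := κ) (y₁ := u (z₁ (φ j)).fst (X₁ j))
      (y₂ := v (z₂ (φ j)).fst (X₂ j)) (q := q) (hα0 (φ j)).le hδ.le
      s1 s2 hes
    have h1 := mul_le_mul_of_nonneg_left hmod hC.le
    have h2 := hest.trans h1
    have h3 := mul_le_mul_of_nonneg_left ha hδ.le
    have h4 := mul_le_mul_of_nonneg_left hbound hδ.le
    have h5 := (abs_le.1 f1)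
    have h6 := (abs_le.1 f2)
    refine le_trans ?_ (h2.trans (mul_le_mul_of_nonneg_left ?_ hC.le))
    · linarith [h5.2, h6.1]
    · linarith
  have hX₁l : Tendsto X₁ atTop (𝓝 zb.snd) := (c2.tendsto zb).comp hlim₁
  have hX₂l : Tendsto X₂ atTop (𝓝 zb.snd) := (c2.tendsto zb).comp hlim₂
  have hχl : Tendsto (fun j => χ (z₁ (φ j)).fst (X₁ j)) atTop (𝓝 (χ zb.fst zb.snd)) := along₁ hχc
  have hul : Tendsto (fun j => u (z₁ (φ j)).fst (X₁ j)) atTop (𝓝 (u zb.fst zb.snd)) := along₁ huc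
  have hvl : Tendsto (fun j => v (z₂ (φ j)).fst (X₂ j)) atTop (𝓝 (v zb.fst zb.snd)) := along₂ hVc
  have hlimL := ((hχl.const_mul δ).const_mul lam).sub (hηφ.const_mul 2)
  have hlimR := ((((((hχl.const_mul δ).const_mul B).add (hωlim.const_mul 2)).add
    ((hηφ.const_mul 2).mul (hX₁l.norm.const_add 1))).add
    ((((hηφ.add_const 1).add (hX₁l.norm.pow m)).add (hX₂l.norm.pow m)).mul
      (hX₁l.sub hX₂l).norm)).add (hul.sub hvl).abs).const_mul C
  -- All error terms vanish and `|u - v|` tends to `δ χ`, leaving `lam δ χ ≤ C (B + 1) δ χ`.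
  have hfinal := le_of_tendsto_of_tendsto hlimL hlimR key
  have hpos := mul_pos hδ hχpos
  rw [hcontact, abs_of_pos hpos, sub_self, norm_zero] at hfinal
  rw [hlam] at hfinal
  linarith

end Uniqueness

end AveragedObstacle

/-! ### Uniqueness, including the initial time. -/

theorem lemma5p6 (n d : ℕ) (T : ℝ) (hT : 0 ≤ T) (c : AveragedObstacle.Coefficients n d)
    (hstanding : c.Standing T) (hforward : c.LipschitzForward) (hbackward : c.LipschitzBackward)
    (hobstacle : c.ObstacleCondition T) (haverage : c.HasAverage)
    (u v : ℝ → AveragedObstacle.Vec n → ℝ)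
    (hu : c.IsViscositySolution T u) (hv : c.IsViscositySolution T v)
    (hu_growth : AveragedObstacle.PolynomialGrowth T u)
    (hv_growth : AveragedObstacle.PolynomialGrowth T v) :
    ∀ t : ℝ, 0 ≤ t → t ≤ T → ∀ x : AveragedObstacle.Vec n, u t x = v t x := by
  have hpos : ∀ t : ℝ, 0 < t → t ≤ T → ∀ x : AveragedObstacle.Vec n, u t x = v t x :=
    fun t h0 hT x => le_antisymm
      (AveragedObstacle.comparison hstanding hforward hbackward haverage hu.1 hv.2
        hu_growth hv_growth h0 hT x)
      (AveragedObstacle.comparison hstanding hforward hbackward haverage hv.1 hu.2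
        hv_growth hu_growth h0 hT x)
  intro t h0 htT x
  rcases h0.eq_or_lt with rfl | h0
  -- If `T = 0`, time `0` is the terminal time; otherwise equality at positive times extends to `0`
  -- by continuity.
  · rcases hT.eq_or_lt with rfl | hT
    · exact le_antisymm ((hu.1.terminal x).trans (hv.2.terminal x))
        ((hv.1.terminal x).trans (hu.2.terminal x))
    · have hlim : ∀ {w : ℝ → AveragedObstacle.Vec n → ℝ},
          ContinuousOn (fun q : ℝ × AveragedObstacle.Vec n => w q.1 q.2)
            (AveragedObstacle.strip n T) →
          Tendsto (fun s => w s x) (𝓝[>] 0) (𝓝 (w 0 x)) := by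
        intro w hw
        have h1 : Tendsto (fun s : ℝ => (s, x)) (𝓝[>] 0)
            (𝓝[AveragedObstacle.strip n T] ((0 : ℝ), x)) := by
          refine tendsto_nhdsWithin_iff.2 ⟨?_, ?_⟩
          · have : Continuous fun s : ℝ => (s, x) := by fun_prop
            exact (this.tendsto 0).mono_left nhdsWithin_le_nhds
          · filter_upwards [Ioc_mem_nhdsGT hT] with s hs
            exact ⟨hs.1.le, hs.2⟩
        exact (hw (0, x) ⟨le_rfl, hT.le⟩).tendsto.comp h1
      refine tendsto_nhds_unique (hlim hu.1.cont) ((hlim hv.1.cont).congr' ?_)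
      filter_upwards [Ioc_mem_nhdsGT hT] with s hs
      exact (hpos s hs.1 hs.2 x).symm
  · exact hpos t h0 htT x
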